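/- Identify $\mathbb{CP}^1$ with the sphere $\mathbb C\cup\{\infty\}$ by $[z:w]\mapsto\zeta=z/w$, oriented by its complex structure. Let the equator $\mathbb{RP}^1=\mathbb R\cup\{\infty\}$ be traversed in the direction of increasing real $\zeta$, and let the (closed) northern and southern hemispheres be the sets $\operatorname{Im}\zeta\ge 0$ and $\operatorname{Im}\zeta\le 0$, both including $\infty$; thus the equator is oriented as the boundary of the northern hemisphere. A flat $U(1)$ gerbe $\mathcal G$ on a space $X$ is a stack of groupoids on the open sets of $X$ that is locally non-empty, in which any two objects over an open set are locally isomorphic, and in which the automorphism sheaf of every object is identified, compatibly with isomorphisms and restrictions, with the sheaf of locally constant $U(1)$-valued functions. Its Giraud class $\gamma(\mathcal G)\in\check H^2(X;U(1))$ (with $U(1)$ discrete) is the class of a cocycle $\gamma_{ijk}=\sigma_{ij}\sigma_{jk}\sigma_{ik}^{-1}$, where $\mathcal O_i$ are objects over the members $\mathcal U_i$ of an open cover and $\sigma_{ij}:\mathcal O_j\to\mathcal O_i$ are isomorphisms over $\mathcal U_i\cap\mathcal U_j$. The value of a class in $\check H^2(\mathbb{CP}^1;U(1))$ on the fundamental cycle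 is obtained by representing the class by a cocycle $\gamma$ on the cover by the open stars of the vertices of the octahedral triangulation of the sphere (with vertices $\zeta=0,1,i,\infty,-1,-i$) and forming the product, over the eight positively oriented triangles $[v_0,v_1,v_2]$ (with the usual exponent $-1$ if the vertices are listed in the opposite order), of the constant values of $\gamma_{v_0v_1v_2}$ on the interiors of these triangles. **Proposition.** Let $\mathcal G$ be a flat $U(1)$ gerbe on $\mathbb{CP}^1$, and let $\mathcal O_+$ and $\mathcal O_-$ be objects of $\mathcal G$ over open neighborhoods $\mathcal U_+$ and $\mathcal U_-$ of the northern and southern hemispheres, respectively. Let $\mathcal O_+\otimes\mathcal O_-^{-1}$ be the flat $U(1)$ bundle over $\mathcal U_+\cap\mathcal U_-$ whose parallel (unit) sections are the isomorphisms $\mathcal O_-\to\mathcal O_+$. Then $\mathcal G$ has a unique Giraud class, its value on the fundamental cycle of $\mathbb{CP}^1$ is well defined, and this value is equal to the holonomy of $\mathcal O_+\otimes\mathcal O_-^{-1}$ around the equator $\mathbb{RP}^1$ (the element of $U(1)$ by which parallel transport once around the equator multiplies). -/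

import Mathlib

open CategoryTheory TopologicalSpace Opposite

universe u v w


/-! ### Čech cohomology in degree two with locally constant coefficients -/

/-- An open cover of `X`. -/
structure OpenCover (X : Type u) [TopologicalSpace X] where
  ι : Type u
  U : ι → Opens X
  covers : ∀ x, ∃ i, x ∈ U i

/-- A Čech 2-cocycle on the cover `𝔘` with values in (the sheaf of locally constant functions to)
the abelian group `A`, written multiplicatively. -/
structure CechCocycle₂ {X : Type u} [TopologicalSpace X] (𝔘 : OpenCover X)
    (A : Type v) [CommGroup A] where
  γ : ∀ i j k, LocallyConstant ↥(𝔘.U i ⊓ 𝔘.U j ⊓ 𝔘.U k) A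
  cocycle : ∀ i j k l (x : X) (hi : x ∈ 𝔘.U i) (hj : x ∈ 𝔘.U j) (hk : x ∈ 𝔘.U k)
    (hl : x ∈ 𝔘.U l),
    γ j k l ⟨x, ⟨hj, hk⟩, hl⟩ * (γ i k l ⟨x, ⟨hi, hk⟩, hl⟩)⁻¹ *
      γ i j l ⟨x, ⟨hi, hj⟩, hl⟩ * (γ i j k ⟨x, ⟨hi, hj⟩, hk⟩)⁻¹ = 1

/-- A Čech 2-cocycle together with the cover on which it is defined. -/
abbrev CechPair₂ (X : Type u) [TopologicalSpace X] (A : Type v) [CommGroup A] :=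
  Σ 𝔘 : OpenCover X, CechCocycle₂ 𝔘 A

/-- Two cocycles are cohomologous if on some common refinement `𝔚` of their covers they differ by
the coboundary of a 1-cochain `b`. -/
def CechPair₂.Cohomologous {X : Type u} [TopologicalSpace X] {A : Type v} [CommGroup A]
    (z z' : CechPair₂ X A) : Prop :=
  ∃ (𝔚 : OpenCover X) (r : 𝔚.ι → z.1.ι) (r' : 𝔚.ι → z'.1.ι)
    (hr : ∀ a x, x ∈ 𝔚.U a → x ∈ z.1.U (r a)) (hr' : ∀ a x, x ∈ 𝔚.U a → x ∈ z'.1.U (r' a))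
    (b : ∀ a c, LocallyConstant ↥(𝔚.U a ⊓ 𝔚.U c) A),
    ∀ a c d (x : X) (ha : x ∈ 𝔚.U a) (hc : x ∈ 𝔚.U c) (hd : x ∈ 𝔚.U d),
      z.2.γ (r a) (r c) (r d) ⟨x, ⟨hr a x ha, hr c x hc⟩, hr d x hd⟩ =
        z'.2.γ (r' a) (r' c) (r' d) ⟨x, ⟨hr' a x ha, hr' c x hc⟩, hr' d x hd⟩ *
          (b c d ⟨x, hc, hd⟩ * (b a d ⟨x, ha, hd⟩)⁻¹ * b a c ⟨x, ha, hc⟩)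

/-- The restriction of a locally constant function to a smaller open set. -/
def LocallyConstant.restr {X : Type u} [TopologicalSpace X] {A : Type v} {U V : Opens X}
    (h : V ≤ U) (g : LocallyConstant U A) : LocallyConstant V A :=
  g.comap ⟨fun x => ⟨x.1, h x.2⟩, by fun_prop⟩

theorem CechPair₂.symm_aux {B : Type v} [AddCommGroup B] (g p q s : B) :
    g = g + (p + -q + s) + (-p + - -q + -s) := by
  abel

theorem CechPair₂.trans_aux {B : Type v} [AddCommGroup B]
    {g g' g'' b₁ b₂ b₃ e₁ e₂ e₃ x₁ x₂ x₃ x₄ x₅ x₆ x₇ x₈ : B}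
    (h : g' = g'' + (e₁ + -e₂ + e₃))
    (k₁ : x₁ + -x₂ + x₃ + -g = 0) (k₂ : x₄ + -x₅ + x₃ + -x₆ = 0)
    (k₃ : g' + -x₅ + x₇ + -x₈ = 0) :
    g + (b₁ + -b₂ + b₃) = g'' + ((b₁ + e₁ + (x₁ + -x₄)) + -(b₂ + e₂ + (x₂ + -x₇)) +
      (b₃ + e₃ + (x₆ + -x₈))) := by
  rw [← sub_eq_zero] at h ⊢
  have : ∀ r₀ r₁ r₂ r₃ : B, r₀ = 0 → r₁ = 0 → r₂ = 0 → r₃ = 0 → r₀ - r₁ + r₂ - r₃ = 0 := by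
    rintro _ _ _ _ rfl rfl rfl rfl; simp
  rw [← this _ _ _ _ h k₁ k₂ k₃]
  abel

theorem CechPair₂.cohomologous_equivalence (X : Type u) [TopologicalSpace X]
    (A : Type v) [CommGroup A] : Equivalence (CechPair₂.Cohomologous (X := X) (A := A)) where
  refl z := ⟨z.1, id, id, fun _ _ h => h, fun _ _ h => h, fun _ _ => 1, by simp⟩
  symm := by
    rintro z z' ⟨𝔚, r, r', hr, hr', b, h⟩
    refine ⟨𝔚, r', r, hr', hr, fun a c => (b a c)⁻¹, fun a c d x ha hc hd => ?_⟩
    rw [h a c d x ha hc hd]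
    simp only [LocallyConstant.coe_inv, Pi.inv_apply]
    exact CechPair₂.symm_aux (B := Additive A) _ _ _ _
  trans := by
    rintro z z' z'' ⟨𝔚, r, s, hr, hs, b, h⟩ ⟨𝔙, t, q, ht, hq, e, k⟩
    let 𝔜 : OpenCover X :=
      { ι := 𝔚.ι × 𝔙.ι
        U := fun a => 𝔚.U a.1 ⊓ 𝔙.U a.2
        covers := fun x => by
          obtain ⟨i, hi⟩ := 𝔚.covers x
          obtain ⟨j, hj⟩ := 𝔙.covers x
          exact ⟨(i, j), hi, hj⟩ }
    have h₁ : ∀ a c, 𝔜.U a ⊓ 𝔜.U c ≤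
        z'.1.U (s a.1) ⊓ z'.1.U (s c.1) ⊓ z'.1.U (t c.2) := fun a c x hx =>
      ⟨⟨hs _ x hx.1.1, hs _ x hx.2.1⟩, ht _ x hx.2.2⟩
    have h₂ : ∀ a c, 𝔜.U a ⊓ 𝔜.U c ≤
        z'.1.U (s a.1) ⊓ z'.1.U (t a.2) ⊓ z'.1.U (t c.2) := fun a c x hx =>
      ⟨⟨hs _ x hx.1.1, ht _ x hx.1.2⟩, ht _ x hx.2.2⟩
    refine ⟨𝔜, fun a => r a.1, fun a => q a.2, fun a x hx => hr _ x hx.1,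
      fun a x hx => hq _ x hx.2,
      fun a c =>
        (b a.1 c.1).restr (inf_le_inf inf_le_left inf_le_left) *
        (e a.2 c.2).restr (inf_le_inf inf_le_right inf_le_right) *
        ((z'.2.γ (s a.1) (s c.1) (t c.2)).restr (h₁ a c) *
          ((z'.2.γ (s a.1) (t a.2) (t c.2)).restr (h₂ a c))⁻¹), ?_⟩
    intro a c d x ha hc hd
    rw [h a.1 c.1 d.1 x ha.1 hc.1 hd.1]
    have h2 := k a.2 c.2 d.2 x ha.2 hc.2 hd.2
    have k1 := z'.2.cocycle (s a.1) (s c.1) (s d.1) (t d.2) x (hs _ x ha.1) (hs _ x hc.1)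
      (hs _ x hd.1) (ht _ x hd.2)
    have k2 := z'.2.cocycle (s a.1) (s c.1) (t c.2) (t d.2) x (hs _ x ha.1) (hs _ x hc.1)
      (ht _ x hc.2) (ht _ x hd.2)
    have k3 := z'.2.cocycle (s a.1) (t a.2) (t c.2) (t d.2) x (hs _ x ha.1) (ht _ x ha.2)
      (ht _ x hc.2) (ht _ x hd.2)
    exact CechPair₂.trans_aux (B := Additive A) h2 k1 k2 k3

/-- The Čech cohomology group `Ȟ²(X; A)` (as a set): cocycles on arbitrary open covers, identified
when they become cohomologous on a common refinement. -/
def CechH2 (X : Type u) [TopologicalSpace X] (A : Type v) [CommGroup A] : Type (max (u + 1) v) :=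
  Quotient (⟨_, CechPair₂.cohomologous_equivalence X A⟩ : Setoid (CechPair₂ X A))

/-- The cohomology class of a cocycle. -/
def CechCocycle₂.cohomologyClass {X : Type u} [TopologicalSpace X] {A : Type v} [CommGroup A]
    {𝔘 : OpenCover X} (z : CechCocycle₂ 𝔘 A) : CechH2 X A :=
  Quotient.mk _ ⟨𝔘, z⟩

/-! ### Flat `U(1)` bundles and flat `U(1)` gerbes -/

/-- A flat `U(1)` bundle over the open set `W`, given by its sheaf of parallel unit sections: a
sheaf on `W` that is locally non-empty and on which the locally constant `U(1)`-valued functions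
act simply transitively. -/
structure FlatU1Bundle {X : Type u} [TopologicalSpace X] (W : Opens X) where
  sections : (Over W)ᵒᵖ ⥤ Type v
  isSheaf : Presheaf.IsSheaf ((Opens.grothendieckTopology X).over W) sections
  action : ∀ V : Over W, MulAction (LocallyConstant V.left Circle) (sections.obj (op V))
  map_smul : ∀ {V V' : Over W} (f : V' ⟶ V) (g : LocallyConstant V.left Circle)
    (s : sections.obj (op V)),
    sections.map f.op (g • s) = g.restr (leOfHom f.left) • sections.map f.op s
  simply_transitive : ∀ (V : Over W) (s t : sections.obj (op V)),
    ∃! g : LocallyConstant V.left Circle, g • s = t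
  locally_nonempty : ∀ x ∈ W, ∃ V : Over W, x ∈ V.left ∧ Nonempty (sections.obj (op V))

attribute [instance] FlatU1Bundle.action

namespace FlatU1Bundle

variable {X : Type u} [TopologicalSpace X] {W : Opens X} (L : FlatU1Bundle.{u, v} W)

/-- Two local sections have the same germ at `x`. -/
def SameGerm {V V' : Over W} (s : L.sections.obj (op V)) (s' : L.sections.obj (op V')) (x : X) :
    Prop :=
  ∃ (Z : Over W) (f : Z ⟶ V) (f' : Z ⟶ V'), x ∈ Z.left ∧
    L.sections.map f.op s = L.sections.map f'.op s'

/-- `h ∈ U(1)` is the holonomy of `L` around the loop `ℓ`: there is a parallel section of `L` along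
`ℓ` (a choice, for every time `t`, of a local section `s t` near `ℓ t`, such that for nearby times
the germs come from one and the same local section) whose final value is `h` times its initial
value. -/
def IsHolonomy (ℓ : C(unitInterval, X)) (h : Circle) : Prop :=
  ∃ (V : unitInterval → Over W) (s : ∀ t, L.sections.obj (op (V t))),
    (∀ t, ℓ t ∈ (V t).left) ∧
    (∀ t, ∀ᶠ t' in nhds t, L.SameGerm (s t') (s t) (ℓ t')) ∧
    L.SameGerm (s 1) (LocallyConstant.const (V 0).left h • s 0) (ℓ 1)

end FlatU1Bundle

open Pseudofunctor.LocallyDiscreteOpToCat in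
/-- A flat `U(1)` gerbe on `X`: a stack of groupoids on the open sets of `X` which is locally
non-empty and locally connected, with band the sheaf of locally constant `U(1)`-valued functions.
-/
structure FlatU1Gerbe (X : Type u) [TopologicalSpace X] where
  stack : Pseudofunctor (LocallyDiscrete (Opens X)ᵒᵖ) Cat.{v, w}
  isStack : stack.IsStack (Opens.grothendieckTopology X)
  isIso : ∀ (U : Opens X) {O P : stack.obj (.mk (op U))} (f : O ⟶ P), IsIso f
  locally_nonempty : ∀ x : X, ∃ U : Opens X, x ∈ U ∧ Nonempty (stack.obj (.mk (op U)))
  locally_connected : ∀ (U : Opens X) (O P : stack.obj (.mk (op U))), ∀ x ∈ U,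
    ∃ (V : Opens X) (f : V ⟶ U), x ∈ V ∧
      Nonempty ((stack.map f.op.toLoc).toFunctor.obj O ⟶ (stack.map f.op.toLoc).toFunctor.obj P)
  /-- The identification of the locally constant `U(1)`-valued functions with the automorphisms of an
  object. -/
  band : ∀ {U : Opens X} (O : stack.obj (.mk (op U))), LocallyConstant U Circle → (O ⟶ O)
  band_mul : ∀ {U : Opens X} (O : stack.obj (.mk (op U))) (g g' : LocallyConstant U Circle),
    band O (g * g') = band O g ≫ band O g'
  band_bijective : ∀ {U : Opens X} (O : stack.obj (.mk (op U))), Function.Bijective (band O)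
  /-- The identification is compatible with isomorphisms of objects ... -/
  band_naturality : ∀ {U : Opens X} {O P : stack.obj (.mk (op U))} (f : O ⟶ P)
    (g : LocallyConstant U Circle), band O g ≫ f = f ≫ band P g
  /-- ... and with restriction to smaller open sets. -/
  band_restr : ∀ {U V : Opens X} (f : V ⟶ U) (O : stack.obj (.mk (op U)))
    (g : LocallyConstant U Circle), (stack.map f.op.toLoc).toFunctor.map (band O g) =
      band ((stack.map f.op.toLoc).toFunctor.obj O) (g.restr (leOfHom f))

namespace FlatU1Gerbe

variable {X : Type u} [TopologicalSpace X] (𝒢 : FlatU1Gerbe.{u, v, w} X)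

/-- The objects of the gerbe that are defined on `U`. -/
abbrev Obj (U : Opens X) : Type w := 𝒢.stack.obj (.mk (op U))

/-- The restriction of an object to a smaller open set. -/
abbrev res {U V : Opens X} (h : V ≤ U) (O : 𝒢.Obj U) : 𝒢.Obj V :=
  (𝒢.stack.map (homOfLE h).op.toLoc).toFunctor.obj O

/-- The restriction of an isomorphism `O|_V → P|_V` to a smaller open set `V'`. -/
abbrev resHom {U₁ U₂ V V' : Opens X} {O : 𝒢.Obj U₁} {P : 𝒢.Obj U₂} {h₁ : V ≤ U₁} {h₂ : V ≤ U₂}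
    (σ : 𝒢.res h₁ O ⟶ 𝒢.res h₂ P) (h : V' ≤ V) :
    𝒢.res (h.trans h₁) O ⟶ 𝒢.res (h.trans h₂) P :=
  Pseudofunctor.LocallyDiscreteOpToCat.pullHom σ (homOfLE h) _ _ rfl rfl

open Pseudofunctor.LocallyDiscreteOpToCat in
theorem pullHom_band {U₁ U₂ V V' : Opens X} {O : 𝒢.Obj U₁} {P : 𝒢.Obj U₂} {f₁ : V ⟶ U₁}
    {f₂ : V ⟶ U₂}
    (σ : (𝒢.stack.map f₁.op.toLoc).toFunctor.obj O ⟶ (𝒢.stack.map f₂.op.toLoc).toFunctor.obj P)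
    (k : V' ⟶ V) (k₁ : V' ⟶ U₁) (k₂ : V' ⟶ U₂) (h₁ : k ≫ f₁ = k₁) (h₂ : k ≫ f₂ = k₂)
    (g : LocallyConstant V Circle) :
    pullHom (σ ≫ 𝒢.band _ g) k k₁ k₂ h₁ h₂ =
      pullHom σ k k₁ k₂ h₁ h₂ ≫ 𝒢.band _ (g.restr (leOfHom k)) := by
  simp only [pullHom, Functor.map_comp, Category.assoc]
  rw [𝒢.band_restr, 𝒢.band_naturality]

theorem band_one {U : Opens X} (O : 𝒢.Obj U) : 𝒢.band O 1 = 𝟙 O := by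
  have := 𝒢.isIso _ (𝒢.band O 1)
  rw [← cancel_epi (𝒢.band O 1), ← 𝒢.band_mul, mul_one, Category.comp_id]

theorem existsUnique_band {U : Opens X} {O P : 𝒢.Obj U} (s t : O ⟶ P) :
    ∃! g : LocallyConstant U Circle, s ≫ 𝒢.band P g = t := by
  have := 𝒢.isIso _ s
  obtain ⟨g, hg⟩ := (𝒢.band_bijective P).2 (inv s ≫ t)
  refine ⟨g, by simp [hg], fun g' hg' => (𝒢.band_bijective P).1 ?_⟩
  simp only [hg, ← hg', IsIso.inv_hom_id_assoc]

/-- The flat `U(1)` bundle `P ⊗ O⁻¹` over `U ⊓ V` attached to an object `P` on `U` and an object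
`O` on `V`: its parallel sections are the isomorphisms from `O` to `P`. -/
noncomputable def quotientBundle {U V : Opens X} (P : 𝒢.Obj U) (O : 𝒢.Obj V) :
    FlatU1Bundle.{u, v} (U ⊓ V) where
  sections := 𝒢.stack.presheafHom (𝒢.res inf_le_right O) (𝒢.res inf_le_left P)
  isSheaf := 𝒢.isStack.toIsPrestack.isSheaf _ _
  action T :=
    { smul := fun g s => s ≫ 𝒢.band _ g
      one_smul := fun s => by
        change s ≫ 𝒢.band _ 1 = s
        rw [band_one]; exact Category.comp_id _
      mul_smul := fun g g' s => by
        change s ≫ 𝒢.band _ (g * g') = (s ≫ 𝒢.band _ g') ≫ 𝒢.band _ g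
        rw [mul_comm, band_mul, Category.assoc] }
  map_smul f g s := 𝒢.pullHom_band s f.left _ _ (Over.w f) (Over.w f) g
  simply_transitive T s t := by
    exact 𝒢.existsUnique_band s t
  locally_nonempty x hx := by
    obtain ⟨Z, f, hxZ, hne⟩ := 𝒢.locally_connected _ (𝒢.res inf_le_right O) (𝒢.res inf_le_left P)
      x hx
    exact ⟨Over.mk f, hxZ, hne⟩

/-- `c` is the Giraud class of `𝒢`: there are an open cover, objects `O i` on its members and
isomorphisms `σ i j` from `O j` to `O i` over the double intersections such that `c` is the class
of the cocycle `γ i j k = σ i j ∘ σ j k ∘ (σ i k)⁻¹`. -/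
def IsGiraudClass (c : CechH2 X Circle) : Prop :=
  ∃ (𝔘 : OpenCover X) (z : CechCocycle₂ 𝔘 Circle) (O : ∀ i, 𝒢.Obj (𝔘.U i))
    (σ : ∀ i j, 𝒢.res (V := 𝔘.U i ⊓ 𝔘.U j) inf_le_right (O j) ⟶ 𝒢.res inf_le_left (O i)),
    c = z.cohomologyClass ∧ ∀ i j k,
      𝒢.resHom (V' := 𝔘.U i ⊓ 𝔘.U j ⊓ 𝔘.U k) (σ j k) (le_inf (inf_le_left.trans inf_le_right)
          inf_le_right) ≫
        𝒢.resHom (σ i j) inf_le_left =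
      𝒢.resHom (σ i k) (le_inf (inf_le_left.trans inf_le_left) inf_le_right) ≫
        𝒢.band _ (z.γ i j k)

end FlatU1Gerbe

/-! ### The projective line -/

/-- The complex projective line. -/
abbrev CP1 : Type := Projectivization ℂ (Fin 2 → ℂ)

/-- The quotient topology on the complex projective line. -/
noncomputable instance CP1.topologicalSpace : TopologicalSpace CP1 :=
  .coinduced (Projectivization.mk' ℂ) inferInstance

namespace CP1

/-- The point of the unit sphere in `ℝ³` that corresponds to `[z : w]`. It is a homeomorphism of
`CP¹` with the unit sphere which takes the orientation given by the complex structure to the one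
given by the outward normal; in the affine coordinate `ζ = z / w` it is
`(1 - |ζ|², 2 Re ζ, 2 Im ζ) / (1 + |ζ|²)`. -/
noncomputable def sphereVec (a : Fin 2 → ℂ) : Fin 3 → ℝ :=
  ![(Complex.normSq (a 1) - Complex.normSq (a 0)) / (Complex.normSq (a 0) + Complex.normSq (a 1)),
    2 * (a 0 * star (a 1)).re / (Complex.normSq (a 0) + Complex.normSq (a 1)),
    2 * (a 0 * star (a 1)).im / (Complex.normSq (a 0) + Complex.normSq (a 1))]

theorem normSq_pos {a : Fin 2 → ℂ} (ha : a ≠ 0) :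
    0 < Complex.normSq (a 0) + Complex.normSq (a 1) := by
  by_contra h
  have h0 := Complex.normSq_nonneg (a 0)
  have h1 := Complex.normSq_nonneg (a 1)
  have e0 : a 0 = 0 := Complex.normSq_eq_zero.1 (by linarith)
  have e1 : a 1 = 0 := Complex.normSq_eq_zero.1 (by linarith)
  apply ha
  ext i
  fin_cases i
  · exact e0
  · exact e1

theorem sphereVec_smul {t : ℂ} {a : Fin 2 → ℂ} (h : t • a ≠ 0) :
    sphereVec (t • a) = sphereVec a := by
  have ht : t ≠ 0 := by rintro rfl; simp at h
  have ha : a ≠ 0 := by rintro rfl; simp at h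
  have ht' : Complex.normSq t ≠ 0 := by simpa using ht
  have e : t * a 0 * star (t * a 1) = (Complex.normSq t : ℂ) * (a 0 * star (a 1)) := by
    rw [star_mul', Complex.star_def, Complex.normSq_eq_conj_mul_self]; ring
  have ha' := (normSq_pos ha).ne'
  simp only [sphereVec, Pi.smul_apply, smul_eq_mul, e, Complex.normSq_mul, ← mul_add, ← mul_sub,
    Complex.re_ofReal_mul, Complex.im_ofReal_mul, mul_left_comm (2 : ℝ),
    mul_div_mul_left _ _ ht']

/-- The coordinates on `CP¹` given by the identification with the unit sphere. -/
noncomputable def coord (p : CP1) : Fin 3 → ℝ :=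
  p.lift (fun a => sphereVec a.1) (by
    rintro a b t hab
    have : a.1 = t • b.1 := hab
    simp only [this]
    exact sphereVec_smul (this ▸ a.2))

theorem continuous_coord : Continuous coord := by
  refine continuous_coinduced_dom.2 ?_
  change Continuous fun a : {a : Fin 2 → ℂ // a ≠ 0} => sphereVec a.1
  refine continuous_pi fun i => ?_
  have h : ∀ a : {a : Fin 2 → ℂ // a ≠ 0},
      Complex.normSq (a.1 0) + Complex.normSq (a.1 1) ≠ 0 := fun a => (normSq_pos a.2).ne'
  have c : ∀ i : Fin 2, Continuous fun a : {a : Fin 2 → ℂ // a ≠ 0} => a.1 i :=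
    fun i => (continuous_apply i).comp continuous_subtype_val
  have c0 := Complex.continuous_normSq.comp (c 0)
  have c1 := Complex.continuous_normSq.comp (c 1)
  have c2 := (c 0).mul (continuous_star.comp (c 1))
  fin_cases i
  · exact (c1.sub c0).div (c0.add c1) h
  · exact (continuous_const.mul (Complex.continuous_re.comp c2)).div (c0.add c1) h
  · exact (continuous_const.mul (Complex.continuous_im.comp c2)).div (c0.add c1) h

theorem exists_coord_ne_zero (p : CP1) : ∃ i, coord p i ≠ 0 := by
  induction p using Projectivization.ind with | h a ha => ?_
  change ∃ i, sphereVec a i ≠ 0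
  have hn := normSq_pos ha
  by_contra! h
  have h0 := h 0
  have h1 := h 1
  have h2 := h 2
  simp only [sphereVec, Matrix.cons_val_zero, Matrix.cons_val_one, Matrix.cons_val, div_eq_zero_iff,
    hn.ne', or_false, mul_eq_zero, OfNat.ofNat_ne_zero, false_or] at h0 h1 h2
  have h3 : Complex.normSq (a 0 * star (a 1)) = 0 := by
    rw [Complex.normSq_apply, h1, h2]; simp
  have h4 : Complex.normSq (a 0) * Complex.normSq (a 1) = 0 := by
    rwa [Complex.star_def, Complex.normSq_mul, Complex.normSq_conj] at h3
  rcases mul_eq_zero.1 h4 with h5 | h5 <;> linarith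

/-- The closed northern hemisphere, `Im (z / w) ≥ 0`. -/
def north : Set CP1 := {p | 0 ≤ coord p 2}

/-- The closed southern hemisphere, `Im (z / w) ≤ 0`. -/
def south : Set CP1 := {p | coord p 2 ≤ 0}

/-- The equator `RP¹`, parametrized by `ζ = tan (π t)`, `0 ≤ t ≤ 1`: its direction is that of
increasing real `ζ`, which is also that of the boundary of the northern hemisphere. -/
noncomputable def equator : C(unitInterval, CP1) where
  toFun t := Projectivization.mk' ℂ
    ⟨![(Real.sin (Real.pi * t) : ℂ), (Real.cos (Real.pi * t) : ℂ)], by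
      intro h
      have h0 := congrFun h 0
      have h1 := congrFun h 1
      simp only [Matrix.cons_val_zero, Matrix.cons_val_one, Pi.zero_apply,
        Complex.ofReal_eq_zero] at h0 h1
      have := Real.sin_sq_add_cos_sq (Real.pi * t)
      simp [h0, h1] at this⟩
  continuous_toFun := by
    refine continuous_coinduced_rng.comp (Continuous.subtype_mk ?_ _)
    refine continuous_pi fun i => ?_
    fin_cases i <;> simp <;> fun_prop

/-- The open cover of `CP¹` by the open stars of the six vertices `± eᵢ` of the octahedral
triangulation of the sphere; the open star of `ε eᵢ` is the open hemisphere around `ε eᵢ`. -/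
noncomputable def octahedralCover : OpenCover CP1 where
  ι := Fin 3 × ℤˣ
  U v := ⟨{p | 0 < ((v.2 : ℤ) : ℝ) * coord p v.1}, isOpen_lt continuous_const
    (continuous_const.mul ((continuous_apply _).comp continuous_coord))⟩
  covers p := by
    obtain ⟨i, hi⟩ := exists_coord_ne_zero p
    rcases lt_or_gt_of_ne hi with h | h
    · exact ⟨(i, -1), by
        change (0 : ℝ) < (((-1 : ℤˣ) : ℤ) : ℝ) * coord p i; simpa using h⟩
    · exact ⟨(i, 1), by
        change (0 : ℝ) < (((1 : ℤˣ) : ℤ) : ℝ) * coord p i; simpa using h⟩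

/-- The open face of the octahedral triangulation with vertices `ε₀ e₀`, `ε₁ e₁`, `ε₂ e₂`. -/
noncomputable def openFace (ε : Fin 3 → ℤˣ) : Opens CP1 :=
  octahedralCover.U (0, ε 0) ⊓ octahedralCover.U (1, ε 1) ⊓ octahedralCover.U (2, ε 2)

/-- `a` is the value of the class `c` on the fundamental cycle of `CP¹`. The fundamental cycle is
the sum of the eight faces of the octahedral triangulation with their positive orientations,
`∑ ε₀ ε₁ ε₂ [ε₀ e₀, ε₁ e₁, ε₂ e₂]` over all signs. To evaluate `c` on it, `c` is represented by a
cocycle `z` on the good cover by the open stars of the vertices, and the value of `z` on the simplex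
`[v₀, v₁, v₂]` is the value of `z.γ v₀ v₁ v₂` on the (connected) open face with these vertices. -/
def IsValueOnFundamentalCycle {A : Type v} [CommGroup A] (c : CechH2 CP1 A) (a : A) : Prop :=
  ∃ (z : CechCocycle₂ octahedralCover A) (p : ∀ ε, openFace ε),
    c = z.cohomologyClass ∧
      a = ∏ ε : Fin 3 → ℤˣ, z.γ (0, ε 0) (1, ε 1) (2, ε 2) (p ε) ^ ((∏ i, ε i : ℤˣ) : ℤ)

end CP1

/-! Each of the three quantities (Giraud class, its value, holonomy) is shown to be unique on its
own; one explicit construction then exhibits all three with the same element `h`.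

Uniqueness of the Giraud class (`IsGiraudClass.unique`) is formal: two systems of objects are
locally isomorphic, and the failure of these isomorphisms to intertwine the two families of gluing
maps is a cochain whose coboundary relates the cocycles. The value on the fundamental cycle is well
defined because open stars are copies of the plane, so a coboundary on a refinement descends to the
octahedral cover (`CechPair₂.Cohomologous.exists_cochain`); overlaps of stars are connected, so the
descended cochain is constant there; and every edge lies in two faces with opposite signs.

For the equality, both objects live over a thin band around the equator. On its intersection with
the star of each equatorial vertex there is an isomorphism from `O₋` to `O₊`. Going round `e₀, e₁,
-e₀, -e₁`, these are normalized to agree with their predecessors, which leaves the whole monodromy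
`h` on the overlap of the stars of `-e₁` and `e₀` (`exists_band_sections`). Parallel transport along
the equator therefore yields `h` (`isHolonomy_equator`). The same transition constants, coned off at
the north pole and made trivial at the south pole, form `octahedralCocycle h`; of the eight faces
only `e₀, -e₁, e₂` contributes, with `h⁻¹` to the exponent `-1`. This cocycle represents the Giraud
class (`isGiraudClass_octahedralCocycle`): refine the octahedral cover by enlarged hemispheres, take
restrictions of `O₊` and `O₋` as objects, glue northern pieces by the transition constants, southern
ones by the identity, and opposite ones by the sections on the band.

To calculate, every isomorphism is encoded by a circle-valued function: a reference object near each
point and a chosen comparison of each object with it give the isomorphism a `value`. Values multiply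
under composition and determine the isomorphism. They vary erratically with the point, but the
quotient for two isomorphisms between the same objects is locally constant. -/

namespace FlatU1Gerbe

/-! ### Restriction and gluing of isomorphisms in the gerbe -/

open Pseudofunctor.LocallyDiscreteOpToCat

variable {X : Type u} [TopologicalSpace X] (𝒢 : FlatU1Gerbe.{u, v, w} X)

theorem resHom_comp {U₁ U₂ U₃ V V' : Opens X} {O : 𝒢.Obj U₁} {P : 𝒢.Obj U₂} {Q : 𝒢.Obj U₃}
    {h₁ : V ≤ U₁} {h₂ : V ≤ U₂} {h₃ : V ≤ U₃}
    (σ : 𝒢.res h₁ O ⟶ 𝒢.res h₂ P) (τ : 𝒢.res h₂ P ⟶ 𝒢.res h₃ Q) (h : V' ≤ V) :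
    𝒢.resHom (σ ≫ τ) h = 𝒢.resHom σ h ≫ 𝒢.resHom τ h := by
  simp only [pullHom, Functor.map_comp, Category.assoc]
  simp [← reassoc_of% Cat.Hom₂.comp_app]

theorem resHom_id {U V V' : Opens X} (O : 𝒢.Obj U) (h₁ : V ≤ U) (h : V' ≤ V) :
    𝒢.resHom (𝟙 (𝒢.res h₁ O)) h = 𝟙 _ := by
  simp [pullHom, ← Cat.Hom₂.comp_app]

theorem resHom_resHom {U₁ U₂ V V' V'' : Opens X} {O : 𝒢.Obj U₁} {P : 𝒢.Obj U₂}
    {h₁ : V ≤ U₁} {h₂ : V ≤ U₂} (σ : 𝒢.res h₁ O ⟶ 𝒢.res h₂ P) (h : V' ≤ V) (h' : V'' ≤ V') :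
    𝒢.resHom (𝒢.resHom σ h) h' = 𝒢.resHom σ (h'.trans h) :=
  pullHom_pullHom σ _ _ _ _ _ _ rfl rfl rfl rfl

theorem resHom_band {U V V' : Opens X} (O : 𝒢.Obj U) (h₁ : V ≤ U) (h : V' ≤ V)
    (g : LocallyConstant V Circle) :
    𝒢.resHom (𝒢.band (𝒢.res h₁ O) g) h = 𝒢.band _ (g.restr h) := by
  have := 𝒢.pullHom_band (𝟙 (𝒢.res h₁ O)) (homOfLE h) _ _ rfl rfl g
  rw [Category.id_comp] at this
  refine this.trans ?_
  rw [show pullHom (𝟙 (𝒢.res h₁ O)) (homOfLE h) _ _ rfl rfl = 𝟙 _ from 𝒢.resHom_id O h₁ h]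
  exact Category.id_comp _

/-- The canonical isomorphism from the restriction of `O` to its iterated restriction. -/
noncomputable def resTrans {U U' V : Opens X} (h : U' ≤ U) (h' : V ≤ U') (O : 𝒢.Obj U) :
    𝒢.res (h'.trans h) O ⟶ 𝒢.res h' (𝒢.res h O) :=
  (𝒢.stack.mapComp' (homOfLE h).op.toLoc (homOfLE h').op.toLoc
    (homOfLE (h'.trans h)).op.toLoc rfl).hom.toNatTrans.app O

theorem resHom_resTrans {U U' V V' : Opens X} (h : U' ≤ U) (h' : V ≤ U') (O : 𝒢.Obj U)
    (k : V' ≤ V) :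
    𝒢.resHom (𝒢.resTrans h h' O) k = 𝒢.resTrans h (k.trans h') O := by
  simp only [pullHom, resTrans]
  rw [𝒢.stack.mapComp'₀₂₃_hom_comp_mapComp'_hom_whiskerRight_app_assoc 
    (homOfLE h).op.toLoc (homOfLE h').op.toLoc (homOfLE k).op.toLoc (homOfLE (h'.trans h)).op.toLoc
    (homOfLE (k.trans h')).op.toLoc (homOfLE (k.trans (h'.trans h))).op.toLoc rfl rfl rfl]
  simp [← Cat.Hom₂.comp_app]

end FlatU1Gerbe

namespace FlatU1Gerbe

open Pseudofunctor.LocallyDiscreteOpToCat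

variable {X : Type u} [TopologicalSpace X] (𝒢 : FlatU1Gerbe.{u, v, w} X)

/-- This is the sheaf property of homomorphisms, the prestack half of the stack condition. -/
theorem exists_amalgamation {V : Opens X} (M N : 𝒢.Obj V) {ι : Type u} (W : ι → Opens X)
    (hW : ∀ i, W i ≤ V) (hcov : ∀ x ∈ V, ∃ i, x ∈ W i)
    (s : ∀ i, 𝒢.res (hW i) M ⟶ 𝒢.res (hW i) N)
    (hs : ∀ i j, 𝒢.resHom (V' := W i ⊓ W j) (s i) inf_le_left = 𝒢.resHom (s j) inf_le_right) :
    ∃ σ : 𝒢.res le_rfl M ⟶ 𝒢.res le_rfl N, ∀ i, 𝒢.resHom σ (hW i) = s i := by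
  have hsh := (isSheaf_iff_isSheaf_of_type _ _).1 (𝒢.isStack.toIsPrestack.isSheaf M N)
  let Z : ι → Over V := fun i => Over.mk (homOfLE (hW i))
  let f : ∀ i, Z i ⟶ Over.mk (𝟙 V) := fun i => Over.homMk (homOfLE (hW i))
  have hmem : Sieve.ofArrows Z f ∈ ((Opens.grothendieckTopology X).over V) (Over.mk (𝟙 V)) := by
    rw [GrothendieckTopology.mem_over_iff, Sieve.overEquiv_ofArrows]
    intro x hx
    obtain ⟨i, hi⟩ := hcov x hx
    exact ⟨W i, homOfLE (hW i), Sieve.ofArrows_mk _ _ i, hi⟩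
  have hfor := (Presieve.isSheafFor_iff_generate _).2 (hsh _ hmem)
  obtain ⟨t, ht, -⟩ := (Presieve.isSheafFor_arrows_iff _ _).1 hfor s (by
    intro i j T p q _
    have h : T.left ≤ W i ⊓ W j := le_inf (leOfHom p.left) (leOfHom q.left)
    have := congrArg (fun a => 𝒢.resHom a h) (hs i j)
    simp only [resHom_resHom] at this
    exact this)
  exact ⟨t, ht⟩

theorem exists_glue {U₁ U₂ V : Opens X} (O : 𝒢.Obj U₁) (P : 𝒢.Obj U₂) (h₁ : V ≤ U₁) (h₂ : V ≤ U₂)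
    {ι : Type u} (W : ι → Opens X)
    (hW : ∀ i, W i ≤ V) (hcov : ∀ x ∈ V, ∃ i, x ∈ W i)
    (s : ∀ i, 𝒢.res ((hW i).trans h₁) O ⟶ 𝒢.res ((hW i).trans h₂) P)
    (hs : ∀ i j, 𝒢.resHom (V' := W i ⊓ W j) (s i) inf_le_left = 𝒢.resHom (s j) inf_le_right) :
    ∃ σ : 𝒢.res h₁ O ⟶ 𝒢.res h₂ P, ∀ i, 𝒢.resHom σ (hW i) = s i := by
  -- The sheaf condition applies to two objects over `V` itself. Inverses `ρ` of the canonical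
  -- isomorphisms `resTrans` translate between restricting directly and restricting by way of `V`.
  have key : ∀ {U V V' : Opens X} (h : V ≤ U) (h' : V' ≤ V) (Q : 𝒢.Obj U),
    ∃ ρ : 𝒢.res h' (𝒢.res h Q) ⟶ 𝒢.res (h'.trans h) Q, ρ ≫ 𝒢.resTrans h h' Q = 𝟙 _ ∧
      𝒢.resTrans h h' Q ≫ ρ = 𝟙 _ := fun h h' Q => by
    have := 𝒢.isIso _ (𝒢.resTrans h h' Q)
    exact ⟨inv (𝒢.resTrans h h' Q), by simp, by simp⟩
  choose ρ hρ hρ' using @key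
  have hρr : ∀ {U V V' V'' : Opens X} (h : V ≤ U) (h' : V' ≤ V) (k : V'' ≤ V') (Q : 𝒢.Obj U),
      𝒢.resHom (ρ h h' Q) k = ρ h (k.trans h') Q := fun h h' k Q => by
    have e := congrArg (fun a => 𝒢.resHom a k) (hρ h h' Q)
    simp only [resHom_comp, resHom_id, resHom_resTrans] at e
    have := 𝒢.isIso _ (𝒢.resTrans h (k.trans h') Q)
    rw [← cancel_mono (𝒢.resTrans h (k.trans h') Q), hρ]
    exact e
  obtain ⟨τ, hτ⟩ := 𝒢.exists_amalgamation (𝒢.res h₁ O) (𝒢.res h₂ P) W hW hcov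
    (fun i => ρ h₁ (hW i) O ≫ s i ≫ 𝒢.resTrans h₂ (hW i) P) (fun i j => by
      simp only [resHom_comp, resHom_resTrans, hρr, hs i j])
  refine ⟨𝒢.resTrans h₁ le_rfl O ≫ τ ≫ ρ h₂ le_rfl P, fun i => ?_⟩
  rw [resHom_comp, resHom_comp, hτ, resHom_resTrans, hρr, Category.assoc, Category.assoc, hρ',
    reassoc_of% hρ', Category.comp_id]

end FlatU1Gerbe

theorem LocallyConstant.eventually_apply_eq {X : Type u} [TopologicalSpace X] {A : Type v}
    {V : Opens X} (g : LocallyConstant V A) {x : X} (hx : x ∈ V) :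
    ∀ᶠ y in nhds x, ∀ hy : y ∈ V, g ⟨y, hy⟩ = g ⟨x, hx⟩ := by
  have h : ∀ᶠ y : V in nhds ⟨x, hx⟩, g y = g ⟨x, hx⟩ :=
    (IsLocallyConstant.iff_eventually_eq _).1 g.isLocallyConstant ⟨x, hx⟩
  rw [nhds_subtype_eq_comap, Filter.eventually_comap] at h
  filter_upwards [h] with y hy hyV using hy ⟨y, hyV⟩ rfl

/-- A function that is locally constant on an open set, as a locally constant function there. -/
def LocallyConstant.ofEventuallyEq {X : Type u} [TopologicalSpace X] {A : Type v} (V : Opens X)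
    (f : X → A) (h : ∀ x ∈ V, ∀ᶠ y in nhds x, f y = f x) : LocallyConstant V A where
  toFun x := f x
  isLocallyConstant := (IsLocallyConstant.iff_eventually_eq _).2 fun x =>
    continuous_subtype_val.continuousAt.eventually (h x x.2)

/-! ### Frames, and isomorphisms as circle-valued functions -/

namespace FlatU1Gerbe

open Pseudofunctor.LocallyDiscreteOpToCat

variable {X : Type u} [TopologicalSpace X] (𝒢 : FlatU1Gerbe.{u, v, w} X)

theorem exists_local_hom {U₁ U₂ : Opens X} (O : 𝒢.Obj U₁) (P : 𝒢.Obj U₂) {x : X}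
    (h₁ : x ∈ U₁) (h₂ : x ∈ U₂) :
    ∃ (V : Opens X) (k₁ : V ≤ U₁) (k₂ : V ≤ U₂), x ∈ V ∧ Nonempty (𝒢.res k₁ O ⟶ 𝒢.res k₂ P) := by
  obtain ⟨V, f, hx, ⟨s⟩⟩ := 𝒢.locally_connected (U₁ ⊓ U₂) (𝒢.res inf_le_left O)
    (𝒢.res inf_le_right P) x ⟨h₁, h₂⟩
  obtain ⟨ρ⟩ : Nonempty (𝒢.res (leOfHom f) (𝒢.res inf_le_right P) ⟶
      𝒢.res ((leOfHom f).trans inf_le_right) P) := by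
    have := 𝒢.isIso _ (𝒢.resTrans inf_le_right (leOfHom f) P)
    exact ⟨inv (𝒢.resTrans inf_le_right (leOfHom f) P)⟩
  exact ⟨V, (leOfHom f).trans inf_le_left, (leOfHom f).trans inf_le_right, hx,
    ⟨𝒢.resTrans inf_le_left (leOfHom f) O ≫ s ≫ ρ⟩⟩

/-- The domain of a reference object near `x`. -/
noncomputable def refOpen (x : X) : Opens X := (𝒢.locally_nonempty x).choose

theorem mem_refOpen (x : X) : x ∈ 𝒢.refOpen x := (𝒢.locally_nonempty x).choose_spec.1

/-- A reference object near `x`. -/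
noncomputable def refObj (x : X) : 𝒢.Obj (𝒢.refOpen x) := (𝒢.locally_nonempty x).choose_spec.2.some

/-- The domain of a comparison of the object `O` with the reference object at `x`. -/
noncomputable def frameOpen {U : Opens X} (O : 𝒢.Obj U) {x : X} (hx : x ∈ U) : Opens X :=
  (𝒢.exists_local_hom (𝒢.refObj x) O (𝒢.mem_refOpen x) hx).choose

theorem frameOpen_le_refOpen {U : Opens X} (O : 𝒢.Obj U) {x : X} (hx : x ∈ U) :
    𝒢.frameOpen O hx ≤ 𝒢.refOpen x :=
  (𝒢.exists_local_hom (𝒢.refObj x) O (𝒢.mem_refOpen x) hx).choose_spec.choose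

theorem frameOpen_le {U : Opens X} (O : 𝒢.Obj U) {x : X} (hx : x ∈ U) :
    𝒢.frameOpen O hx ≤ U :=
  (𝒢.exists_local_hom (𝒢.refObj x) O (𝒢.mem_refOpen x) hx).choose_spec.choose_spec.choose

theorem mem_frameOpen {U : Opens X} (O : 𝒢.Obj U) {x : X} (hx : x ∈ U) :
    x ∈ 𝒢.frameOpen O hx :=
  (𝒢.exists_local_hom (𝒢.refObj x) O
    (𝒢.mem_refOpen x) hx).choose_spec.choose_spec.choose_spec.1

/-- A comparison of the object `O` with the reference object at `x`. -/
noncomputable def frame {U : Opens X} (O : 𝒢.Obj U) {x : X} (hx : x ∈ U) :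
    𝒢.res (𝒢.frameOpen_le_refOpen O hx) (𝒢.refObj x) ⟶ 𝒢.res (𝒢.frameOpen_le O hx) O :=
  (𝒢.exists_local_hom (𝒢.refObj x) O
    (𝒢.mem_refOpen x) hx).choose_spec.choose_spec.choose_spec.2.some

/-- `c` is the value at `x` of the isomorphism `σ`, with respect to the chosen frames. -/
def IsValueAt {U₁ U₂ V : Opens X} {O : 𝒢.Obj U₁} {P : 𝒢.Obj U₂} {h₁ : V ≤ U₁} {h₂ : V ≤ U₂}
    (σ : 𝒢.res h₁ O ⟶ 𝒢.res h₂ P) (x : X) (c : Circle) : Prop :=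
  ∃ (hx : x ∈ V) (W : Opens X) (hxW : x ∈ W) (hV : W ≤ V) (hO : W ≤ 𝒢.frameOpen O (h₁ hx))
    (hP : W ≤ 𝒢.frameOpen P (h₂ hx)) (g : LocallyConstant W Circle), g ⟨x, hxW⟩ = c ∧
    𝒢.resHom (𝒢.frame O (h₁ hx)) hO ≫ 𝒢.resHom σ hV =
      𝒢.resHom (𝒢.frame P (h₂ hx)) hP ≫ 𝒢.band _ g

section values

variable {U₁ U₂ U₃ V V' : Opens X} {O : 𝒢.Obj U₁} {P : 𝒢.Obj U₂} {Q : 𝒢.Obj U₃}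
  {h₁ : V ≤ U₁} {h₂ : V ≤ U₂} {h₃ : V ≤ U₃}

theorem exists_isValueAt (σ : 𝒢.res h₁ O ⟶ 𝒢.res h₂ P) {x : X} (hx : x ∈ V) :
    ∃ c, 𝒢.IsValueAt σ x c := by
  let W : Opens X := V ⊓ 𝒢.frameOpen O (h₁ hx) ⊓ 𝒢.frameOpen P (h₂ hx)
  have hV : W ≤ V := inf_le_left.trans inf_le_left
  have hO : W ≤ 𝒢.frameOpen O (h₁ hx) := inf_le_left.trans inf_le_right
  have hP : W ≤ 𝒢.frameOpen P (h₂ hx) := inf_le_right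
  obtain ⟨g, hg, -⟩ := 𝒢.existsUnique_band (𝒢.resHom (𝒢.frame P (h₂ hx)) hP)
    (𝒢.resHom (𝒢.frame O (h₁ hx)) hO ≫ 𝒢.resHom σ hV)
  exact ⟨_, hx, W, ⟨⟨hx, 𝒢.mem_frameOpen _ _⟩, 𝒢.mem_frameOpen _ _⟩, hV, hO, hP, g, rfl, hg.symm⟩

variable {𝒢} in
theorem IsValueAt.restr {σ : 𝒢.res h₁ O ⟶ 𝒢.res h₂ P} {x : X} {c : Circle}
    (h : 𝒢.IsValueAt σ x c) : ∃ (hx : x ∈ V) (W : Opens X) (_ : x ∈ W), ∀ (W' : Opens X)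
      (_ : W' ≤ W) (hxW : x ∈ W'), ∃ (hV : W' ≤ V) (hO : W' ≤ 𝒢.frameOpen O (h₁ hx))
    (hP : W' ≤ 𝒢.frameOpen P (h₂ hx)) (g : LocallyConstant W' Circle), g ⟨x, hxW⟩ = c ∧
    𝒢.resHom (𝒢.frame O (h₁ hx)) hO ≫ 𝒢.resHom σ hV =
      𝒢.resHom (𝒢.frame P (h₂ hx)) hP ≫ 𝒢.band _ g := by
  obtain ⟨hx, W, hxW, hV, hO, hP, g, hg, e⟩ := h
  refine ⟨hx, W, hxW, fun W' hW' hxW' => ⟨hW'.trans hV, hW'.trans hO, hW'.trans hP, g.restr hW',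
    hg, ?_⟩⟩
  have := congrArg (fun a => 𝒢.resHom a hW') e
  simp only [resHom_comp, resHom_resHom, resHom_band] at this
  exact this

theorem band_left_cancel {U : Opens X} {O P : 𝒢.Obj U} (s : O ⟶ P) {g g' : LocallyConstant U Circle}
    (h : s ≫ 𝒢.band P g = s ≫ 𝒢.band P g') : g = g' :=
  (𝒢.existsUnique_band s (s ≫ 𝒢.band P g)).unique rfl h.symm

theorem IsValueAt.unique {σ : 𝒢.res h₁ O ⟶ 𝒢.res h₂ P} {x : X} {c c' : Circle}
    (h : 𝒢.IsValueAt σ x c) (h' : 𝒢.IsValueAt σ x c') : c = c' := by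
  obtain ⟨hx, W, hxW, k⟩ := h.restr
  obtain ⟨_, W', hxW', k'⟩ := h'.restr
  obtain ⟨_, _, _, g, rfl, e⟩ := k (W ⊓ W') inf_le_left ⟨hxW, hxW'⟩
  obtain ⟨_, _, _, g', rfl, e'⟩ := k' (W ⊓ W') inf_le_right ⟨hxW, hxW'⟩
  rw [𝒢.band_left_cancel _ (e.symm.trans e')]

theorem IsValueAt.comp {σ : 𝒢.res h₁ O ⟶ 𝒢.res h₂ P} {τ : 𝒢.res h₂ P ⟶ 𝒢.res h₃ Q} {x : X}
    {c c' : Circle} (h : 𝒢.IsValueAt σ x c) (h' : 𝒢.IsValueAt τ x c') :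
    𝒢.IsValueAt (σ ≫ τ) x (c * c') := by
  obtain ⟨hx, W, hxW, k⟩ := h.restr
  obtain ⟨_, W', hxW', k'⟩ := h'.restr
  obtain ⟨hV, hO, hP, g, rfl, e⟩ := k (W ⊓ W') inf_le_left ⟨hxW, hxW'⟩
  obtain ⟨_, _, hQ, g', rfl, e'⟩ := k' (W ⊓ W') inf_le_right ⟨hxW, hxW'⟩
  refine ⟨hx, W ⊓ W', ⟨hxW, hxW'⟩, hV, hO, hQ, g * g', rfl, ?_⟩
  rw [resHom_comp, reassoc_of% e, 𝒢.band_naturality, reassoc_of% e', mul_comm, 𝒢.band_mul]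

theorem IsValueAt.resHom {σ : 𝒢.res h₁ O ⟶ 𝒢.res h₂ P} {x : X} {c : Circle}
    (h : 𝒢.IsValueAt σ x c) (hV : V' ≤ V) (hx' : x ∈ V') :
    𝒢.IsValueAt (𝒢.resHom σ hV) x c := by
  obtain ⟨hx, W, hxW, k⟩ := h.restr
  obtain ⟨hV', hO, hP, g, rfl, e⟩ := k (W ⊓ V') inf_le_left ⟨hxW, hx'⟩
  refine ⟨hx', W ⊓ V', ⟨hxW, hx'⟩, inf_le_right, hO, hP, g, rfl, ?_⟩
  rw [resHom_resHom]
  exact e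

theorem isValueAt_band (g : LocallyConstant V Circle) {x : X} (hx : x ∈ V) :
    𝒢.IsValueAt (𝒢.band (𝒢.res h₁ O) g) x (g ⟨x, hx⟩) := by
  refine ⟨hx, V ⊓ 𝒢.frameOpen O (h₁ hx), ⟨hx, 𝒢.mem_frameOpen _ _⟩, inf_le_left, inf_le_right,
    inf_le_right, g.restr inf_le_left, rfl, ?_⟩
  rw [resHom_band]

open Classical in
/-- The value at `x` of an isomorphism of objects, with respect to the chosen frames. -/
noncomputable def value (σ : 𝒢.res h₁ O ⟶ 𝒢.res h₂ P) (x : X) : Circle :=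
  if h : ∃ c, 𝒢.IsValueAt σ x c then h.choose else 1

theorem isValueAt_value (σ : 𝒢.res h₁ O ⟶ 𝒢.res h₂ P) {x : X} (hx : x ∈ V) :
    𝒢.IsValueAt σ x (𝒢.value σ x) := by
  have h := 𝒢.exists_isValueAt σ hx
  rw [value, dif_pos h]
  exact h.choose_spec

variable {𝒢} in
theorem IsValueAt.value_eq {σ : 𝒢.res h₁ O ⟶ 𝒢.res h₂ P} {x : X} {c : Circle}
    (h : 𝒢.IsValueAt σ x c) : 𝒢.value σ x = c :=
  (𝒢.isValueAt_value σ h.choose).unique _ h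

theorem value_comp (σ : 𝒢.res h₁ O ⟶ 𝒢.res h₂ P) (τ : 𝒢.res h₂ P ⟶ 𝒢.res h₃ Q) {x : X}
    (hx : x ∈ V) : 𝒢.value (σ ≫ τ) x = 𝒢.value σ x * 𝒢.value τ x :=
  ((𝒢.isValueAt_value σ hx).comp 𝒢 (𝒢.isValueAt_value τ hx)).value_eq

theorem value_resHom (σ : 𝒢.res h₁ O ⟶ 𝒢.res h₂ P) (hV : V' ≤ V) {x : X} (hx : x ∈ V') :
    𝒢.value (𝒢.resHom σ hV) x = 𝒢.value σ x :=
  ((𝒢.isValueAt_value σ (hV hx)).resHom 𝒢 hV hx).value_eq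

theorem value_band (g : LocallyConstant V Circle) {x : X} (hx : x ∈ V) :
    𝒢.value (𝒢.band (𝒢.res h₁ O) g) x = g ⟨x, hx⟩ :=
  (𝒢.isValueAt_band g hx).value_eq

/-- Two parallel isomorphisms differ by a unique band element, whose values are the quotients of
their values. -/
theorem value_ext {σ σ' : 𝒢.res h₁ O ⟶ 𝒢.res h₂ P} (h : ∀ x ∈ V, 𝒢.value σ x = 𝒢.value σ' x) :
    σ = σ' := by
  obtain ⟨g, hg, -⟩ := 𝒢.existsUnique_band σ σ'
  have : g = 1 := by
    refine LocallyConstant.ext fun ⟨x, hx⟩ => ?_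
    have := h x hx
    rw [← hg, value_comp _ _ _ hx, value_band _ _ hx] at this
    exact mul_eq_left.1 this.symm
  rw [← hg, this, band_one, Category.comp_id]

theorem exists_value_eq_mul (σ σ' : 𝒢.res h₁ O ⟶ 𝒢.res h₂ P) :
    ∃ g : LocallyConstant V Circle, ∀ x (hx : x ∈ V), 𝒢.value σ' x = g ⟨x, hx⟩ * 𝒢.value σ x := by
  obtain ⟨g, hg, -⟩ := 𝒢.existsUnique_band σ σ'
  refine ⟨g, fun x hx => ?_⟩
  rw [← hg, value_comp _ _ _ hx, value_band _ _ hx, mul_comm]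

end values

/-- The function `f` represents, near `x`, an isomorphism from `O` to `P`. -/
def Parallel {U₁ U₂ : Opens X} (O : 𝒢.Obj U₁) (P : 𝒢.Obj U₂) (f : X → Circle) (x : X) : Prop :=
  ∃ (V : Opens X) (h₁ : V ≤ U₁) (h₂ : V ≤ U₂) (σ : 𝒢.res h₁ O ⟶ 𝒢.res h₂ P), x ∈ V ∧
    ∀ y ∈ V, 𝒢.value σ y = f y

section parallel

variable {U₁ U₂ U₃ : Opens X} {O : 𝒢.Obj U₁} {P : 𝒢.Obj U₂} {Q : 𝒢.Obj U₃}

theorem parallel_value {V : Opens X} {h₁ : V ≤ U₁} {h₂ : V ≤ U₂}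
    (σ : 𝒢.res h₁ O ⟶ 𝒢.res h₂ P) {x : X} (hx : x ∈ V) : 𝒢.Parallel O P (𝒢.value σ) x :=
  ⟨V, h₁, h₂, σ, hx, fun _ _ => rfl⟩

theorem exists_parallel (O : 𝒢.Obj U₁) (P : 𝒢.Obj U₂) {x : X} (h₁ : x ∈ U₁) (h₂ : x ∈ U₂) :
    ∃ f, 𝒢.Parallel O P f x := by
  obtain ⟨V, k₁, k₂, hx, ⟨σ⟩⟩ := 𝒢.exists_local_hom O P h₁ h₂
  exact ⟨_, 𝒢.parallel_value σ hx⟩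

variable {𝒢} {f f' : X → Circle} {x : X}

theorem Parallel.congr (h : 𝒢.Parallel O P f x) (hf : ∀ᶠ y in nhds x, f y = f' y) :
    𝒢.Parallel O P f' x := by
  obtain ⟨V, h₁, h₂, σ, hx, hσ⟩ := h
  obtain ⟨W, hW, hWo, hxW⟩ := eventually_nhds_iff.1 hf
  let W' : Opens X := ⟨W, hWo⟩
  refine ⟨V ⊓ W', inf_le_left.trans h₁, inf_le_left.trans h₂, 𝒢.resHom σ inf_le_left, ⟨hx, hxW⟩,
    fun y hy => ?_⟩
  rw [𝒢.value_resHom _ _ hy, hσ y hy.1, hW y hy.2]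

theorem Parallel.eventually (h : 𝒢.Parallel O P f x) :
    ∀ᶠ y in nhds x, 𝒢.Parallel O P f y := by
  obtain ⟨V, h₁, h₂, σ, hx, hσ⟩ := h
  filter_upwards [V.isOpen.mem_nhds hx] with y hy
  exact ⟨V, h₁, h₂, σ, hy, hσ⟩

theorem Parallel.mul (h : 𝒢.Parallel O P f x) (h' : 𝒢.Parallel P Q f' x) :
    𝒢.Parallel O Q (f * f') x := by
  obtain ⟨V, h₁, h₂, σ, hx, hσ⟩ := h
  obtain ⟨V', h₁', h₂', σ', hx', hσ'⟩ := h'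
  refine ⟨V ⊓ V', inf_le_left.trans h₁, inf_le_right.trans h₂',
    𝒢.resHom σ inf_le_left ≫ 𝒢.resHom σ' inf_le_right, ⟨hx, hx'⟩, fun y hy => ?_⟩
  rw [𝒢.value_comp _ _ hy, 𝒢.value_resHom _ _ hy, 𝒢.value_resHom _ _ hy, hσ y hy.1, hσ' y hy.2]
  rfl

theorem parallel_const (O : 𝒢.Obj U₁) (hx : x ∈ U₁) (c : Circle) :
    𝒢.Parallel O O (fun _ => c) x :=
  ⟨U₁, le_rfl, le_rfl, 𝒢.band _ (LocallyConstant.const _ c), hx, fun _ hy => 𝒢.value_band _ hy⟩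

theorem Parallel.mem_left (h : 𝒢.Parallel O P f x) : x ∈ U₁ := by
  obtain ⟨V, h₁, h₂, σ, hx, hσ⟩ := h
  exact h₁ hx

theorem Parallel.const_mul (h : 𝒢.Parallel O P f x) (c : Circle) :
    𝒢.Parallel O P (fun y => c * f y) x :=
  (parallel_const O h.mem_left c).mul h

theorem Parallel.inv (h : 𝒢.Parallel O P f x) : 𝒢.Parallel P O f⁻¹ x := by
  obtain ⟨V, h₁, h₂, σ, hx, hσ⟩ := h
  have := 𝒢.isIso _ σ
  refine ⟨V, h₂, h₁, CategoryTheory.inv σ, hx, fun y hy => ?_⟩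
  have e := 𝒢.value_comp (CategoryTheory.inv σ) σ hy
  rw [IsIso.inv_hom_id, ← band_one, 𝒢.value_band _ hy, hσ y hy] at e
  exact eq_inv_of_mul_eq_one_left e.symm

/-- The arbitrary frames cancel in the quotient, which is the locally constant function relating the
two isomorphisms. -/
theorem Parallel.eventually_eq (h : 𝒢.Parallel O P f x) (h' : 𝒢.Parallel O P f' x) :
    ∀ᶠ y in nhds x, f' y * (f y)⁻¹ = f' x * (f x)⁻¹ := by
  obtain ⟨V, h₁, h₂, σ, hx, hσ⟩ := h
  obtain ⟨V', h₁', h₂', σ', hx', hσ'⟩ := h'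
  obtain ⟨g, hg⟩ := 𝒢.exists_value_eq_mul (𝒢.resHom (V' := V ⊓ V') σ inf_le_left)
    (𝒢.resHom σ' inf_le_right)
  have key : ∀ y (hy : y ∈ V ⊓ V'), f' y * (f y)⁻¹ = g ⟨y, hy⟩ := fun y hy => by
    have := hg y hy
    rw [𝒢.value_resHom _ _ hy, 𝒢.value_resHom _ _ hy, hσ y hy.1, hσ' y hy.2] at this
    rw [this, mul_inv_cancel_right]
  filter_upwards [g.eventually_apply_eq (x := x) ⟨hx, hx'⟩, 
    (V ⊓ V').isOpen.mem_nhds ⟨hx, hx'⟩] with y hy hyV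
  rw [key y hyV, key x ⟨hx, hx'⟩]
  exact hy hyV

/-- Local isomorphisms with the prescribed values coincide on overlaps by `value_ext`, hence glue.
-/
theorem exists_hom_of_parallel {V : Opens X} (h₁ : V ≤ U₁) (h₂ : V ≤ U₂)
    (h : ∀ x ∈ V, 𝒢.Parallel O P f x) :
    ∃ σ : 𝒢.res h₁ O ⟶ 𝒢.res h₂ P, ∀ x ∈ V, 𝒢.value σ x = f x := by
  choose W k₁ k₂ s hxW hs using fun x : V => h x x.2
  obtain ⟨σ, hσ⟩ := 𝒢.exists_glue O P h₁ h₂ (fun x => W x ⊓ V) (fun _ => inf_le_right)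
    (fun x hx => ⟨⟨x, hx⟩, hxW _, hx⟩) (fun x => 𝒢.resHom (s x) inf_le_left) (fun i j => by
      refine 𝒢.value_ext fun x hx => ?_
      rw [𝒢.value_resHom _ _ hx, 𝒢.value_resHom _ _ hx, 𝒢.value_resHom _ _ hx.1,
        𝒢.value_resHom _ _ hx.2, hs _ _ hx.1.1, hs _ _ hx.2.1])
  refine ⟨σ, fun x hx => ?_⟩
  have := 𝒢.value_resHom σ (V' := W ⟨x, hx⟩ ⊓ V) inf_le_right (x := x) ⟨hxW _, hx⟩
  rw [hσ, 𝒢.value_resHom _ _ (show x ∈ W ⟨x, hx⟩ ⊓ V from ⟨hxW ⟨x, hx⟩, hx⟩),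
    hs _ _ (hxW ⟨x, hx⟩)] at this
  exact this.symm

variable (𝒢) in
/-- The value of the canonical isomorphism from `O` to a restriction of it. -/
noncomputable def resValue {U U' : Opens X} (h : U' ≤ U) (O : 𝒢.Obj U) : X → Circle :=
  𝒢.value (h₁ := h) (h₂ := le_rfl) (𝒢.resTrans h le_rfl O)

theorem parallel_resValue {U U' : Opens X} (h : U' ≤ U) (O : 𝒢.Obj U) (hx : x ∈ U') :
    𝒢.Parallel O (𝒢.res h O) (𝒢.resValue h O) x :=
  𝒢.parallel_value (h₁ := h) (h₂ := le_rfl) (𝒢.resTrans h le_rfl O) hx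

/-- A restricted object has frames of its own, unrelated to those of the original object; the
factors `resValue` account for the change. -/
theorem Parallel.res {U₁' U₂' : Opens X} (h : 𝒢.Parallel O P f x) (k₁ : U₁' ≤ U₁) (k₂ : U₂' ≤ U₂)
    (h₁ : x ∈ U₁') (h₂ : x ∈ U₂') :
    𝒢.Parallel (𝒢.res k₁ O) (𝒢.res k₂ P)
      (fun y => (𝒢.resValue k₁ O y)⁻¹ * f y * 𝒢.resValue k₂ P y) x :=
  ((parallel_resValue k₁ O h₁).inv.mul h).mul (parallel_resValue k₂ P h₂)

end parallel

end FlatU1Gerbe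

/-! ### Germs up to constants, and their sections on the plane -/

theorem IsPreconnected.apply_eq_of_eventually_eq {D : Type u} [TopologicalSpace D] {A : Type v}
    {S : Set D} (hS : IsPreconnected S) {f : D → A} (hf : ∀ x ∈ S, ∀ᶠ y in nhds x, f y = f x)
    {x y : D} (hx : x ∈ S) (hy : y ∈ S) : f x = f y := by
  let _ : TopologicalSpace A := ⊥
  have : DiscreteTopology A := ⟨rfl⟩
  exact hS.constant (fun z hz => (by
    rw [ContinuousWithinAt, nhds_discrete, Filter.tendsto_pure]
    exact nhdsWithin_le_nhds (hf z hz))) hx hy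

section germs

variable {D : Type u} [TopologicalSpace D] {A : Type v} [CommGroup A]

/-- A family of germs `ρ x` of functions at the points `x` of `S` such that, for `y` near `x`, the
germs at `y` of `ρ x` and `ρ y` differ by a constant. -/
def CompatibleGerms (ρ : D → D → A) (S : Set D) : Prop :=
  ∀ x ∈ S, ∀ᶠ y in nhds x, ∃ c, ∀ᶠ z in nhds y, ρ y z = c * ρ x z

/-- A function whose germ at every point of `S` agrees, up to a constant, with `ρ`. -/
def IsGermSection (ρ : D → D → A) (S : Set D) (F : D → A) : Prop :=
  ∀ x ∈ S, ∃ c, ∀ᶠ y in nhds x, F y = c * ρ x y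

variable {ρ : D → D → A}

theorem IsGermSection.mono {S T : Set D} {F : D → A} (h : IsGermSection ρ S F) (hT : T ⊆ S) :
    IsGermSection ρ T F :=
  fun x hx => h x (hT hx)

theorem CompatibleGerms.exists_isGermSection_nhds {S : Set D} (h : CompatibleGerms ρ S) {x : D}
    (hx : x ∈ S) : ∃ T ∈ nhds x, ∃ F, IsGermSection ρ T F := by
  refine ⟨_, h x hx, ρ x, fun y ⟨c, hc⟩ => ⟨c⁻¹, ?_⟩⟩
  filter_upwards [hc] with z hz
  rw [hz, inv_mul_cancel_left]

theorem IsGermSection.eventually_eq {S T : Set D} {F G : D → A} (hF : IsGermSection ρ S F)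
    (hG : IsGermSection ρ T G) {x : D} (hx : x ∈ S ∩ T) :
    ∀ᶠ y in nhds x, F y * (G y)⁻¹ = F x * (G x)⁻¹ := by
  obtain ⟨c, hc⟩ := hF x hx.1
  obtain ⟨d, hd⟩ := hG x hx.2
  have key : ∀ y, F y = c * ρ x y → G y = d * ρ x y → F y * (G y)⁻¹ = c * d⁻¹ := by
    intro y h₁ h₂
    rw [h₁, h₂, mul_inv, mul_mul_mul_comm, mul_inv_cancel, mul_one]
  filter_upwards [hc, hd] with y h₁ h₂
  rw [key y h₁ h₂, key x hc.self_of_nhds hd.self_of_nhds]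

/-- On the connected overlap the quotient of the sections is one constant; rescaling by it makes
them fit. -/
theorem IsGermSection.exists_union {S T : Set D} {F G : D → A} (hF : IsGermSection ρ S F)
    (hG : IsGermSection ρ T G) (hS : IsOpen S) (hT : IsOpen T) (hST : IsPreconnected (S ∩ T)) :
    ∃ H, IsGermSection ρ (S ∪ T) H := by
  classical
  obtain ⟨c, hc⟩ : ∃ c, ∀ x ∈ S ∩ T, F x = c * G x := by
    by_cases hne : (S ∩ T).Nonempty
    · obtain ⟨x₀, hx₀⟩ := hne
      refine ⟨F x₀ * (G x₀)⁻¹, fun x hx => ?_⟩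
      rw [hST.apply_eq_of_eventually_eq (f := fun y => F y * (G y)⁻¹)
        (fun x hx => hF.eventually_eq hG hx) hx₀ hx, inv_mul_cancel_right]
    · exact ⟨1, fun x hx => (hne ⟨x, hx⟩).elim⟩
  refine ⟨fun x => if x ∈ S then F x else c * G x, ?_⟩
  rintro x (hx | hx)
  · obtain ⟨d, hd⟩ := hF x hx
    refine ⟨d, ?_⟩
    filter_upwards [hd, hS.mem_nhds hx] with y hy hyS
    rw [if_pos hyS, hy]
  · obtain ⟨d, hd⟩ := hG x hx
    refine ⟨c * d, ?_⟩
    filter_upwards [hd, hT.mem_nhds hx] with y hy hyT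
    rw [mul_assoc, ← hy]
    split_ifs with h
    · exact hc y ⟨h, hyT⟩
    · rfl

end germs

/-- Compactness of an interval in inductive form: the supremum of the reachable right endpoints
cannot fall short of `b`. -/
theorem interval_induction {Q : ℝ → ℝ → Prop}
    (mono : ∀ {a b a' b'}, a ≤ a' → b' ≤ b → Q a b → Q a' b')
    (glue : ∀ {a b a' b'}, a' < b → Q a b → Q a' b' → Q a b')
    (loc : ∀ t, ∃ ε > 0, Q (t - ε) (t + ε)) (a b : ℝ) : Q a b := by
  obtain ⟨δ, hδ, hQ⟩ := loc a
  rcases lt_or_ge b a with hab | hab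
  · exact mono (by linarith) (by linarith) hQ
  let s : Set ℝ := {t | t ∈ Set.Icc a b ∧ ∃ ε > 0, Q a (t + ε)}
  have has : a ∈ s := ⟨⟨le_rfl, hab⟩, δ, hδ, mono (by linarith) le_rfl hQ⟩
  have hbd : BddAbove s := ⟨b, fun t ht => ht.1.2⟩
  obtain ⟨ε, hε, hQε⟩ := loc (sSup s)
  obtain ⟨t, ⟨⟨hat, htb⟩, ε', hε', ht⟩, hlt⟩ :=
    exists_lt_of_lt_csSup ⟨a, has⟩ (show sSup s - ε < sSup s by linarith)
  have key : Q a (sSup s + ε) := glue (by linarith) ht hQε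
  rcases le_or_gt b (sSup s + ε / 2) with h | h
  · exact mono le_rfl (by linarith) key
  -- Only half of `ε` is spent, since membership in `s` demands room beyond the point.
  · have : sSup s + ε / 2 ∈ s :=
      ⟨⟨by linarith [le_csSup hbd has], h.le⟩, ε / 2, by linarith, by
        rwa [add_assoc, add_halves]⟩
    linarith [le_csSup hbd this]

section plane

variable {A : Type v} [CommGroup A] {ρ : ℝ × ℝ → ℝ × ℝ → A}

theorem isPreconnected_box_inter (a b c d a' b' c' d' : ℝ) :
    IsPreconnected ((Set.Ioo a b ×ˢ Set.Ioo c d) ∩ (Set.Ioo a' b' ×ˢ Set.Ioo c' d')) := by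
  rw [Set.prod_inter_prod]
  exact (((convex_Ioo _ _).inter (convex_Ioo _ _)).prod
    ((convex_Ioo _ _).inter (convex_Ioo _ _))).isPreconnected

theorem CompatibleGerms.exists_isGermSection_box (h : CompatibleGerms ρ Set.univ) (a b c d : ℝ) :
    ∃ F, IsGermSection ρ (Set.Ioo a b ×ˢ Set.Ioo c d) F := by
  have hglue : ∀ {a b c d a' b' c' d' : ℝ} {S : Set (ℝ × ℝ)},
      (∃ F, IsGermSection ρ (Set.Ioo a b ×ˢ Set.Ioo c d) F) →
      (∃ F, IsGermSection ρ (Set.Ioo a' b' ×ˢ Set.Ioo c' d') F) →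
      S ⊆ (Set.Ioo a b ×ˢ Set.Ioo c d) ∪ (Set.Ioo a' b' ×ˢ Set.Ioo c' d') →
      ∃ F, IsGermSection ρ S F := by
    rintro a b c d a' b' c' d' S ⟨F, hF⟩ ⟨G, hG⟩ hS
    obtain ⟨H, hH⟩ := hF.exists_union hG (isOpen_Ioo.prod isOpen_Ioo) (isOpen_Ioo.prod isOpen_Ioo)
      (isPreconnected_box_inter _ _ _ _ _ _ _ _)
    exact ⟨H, hH.mono hS⟩
  have hmono : ∀ {S T : Set (ℝ × ℝ)}, S ⊆ T → (∃ F, IsGermSection ρ T F) →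
      ∃ F, IsGermSection ρ S F := fun hST ⟨F, hF⟩ => ⟨F, hF.mono hST⟩
  -- Gluing proceeds vertically first, over a strip around `x` whose width may shrink at each step,
  -- and then horizontally from strip to strip.
  have strip : ∀ x c d, ∃ ε > 0,
      ∃ F, IsGermSection ρ (Set.Ioo (x - ε) (x + ε) ×ˢ Set.Ioo c d) F := by
    intro x
    refine interval_induction (Q := fun c d => ∃ ε > 0,
      ∃ F, IsGermSection ρ (Set.Ioo (x - ε) (x + ε) ×ˢ Set.Ioo c d) F) ?_ ?_ ?_
    · rintro c d c' d' hc hd ⟨ε, hε, H⟩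
      exact ⟨ε, hε, hmono (Set.prod_mono le_rfl (Set.Ioo_subset_Ioo hc hd)) H⟩
    · rintro c d c' d' hcd ⟨ε, hε, H⟩ ⟨ε', hε', H'⟩
      refine ⟨min ε ε', lt_min hε hε', hglue H H' ?_⟩
      rintro ⟨y, z⟩ ⟨⟨hy, hy'⟩, hz, hz'⟩
      have := min_le_left ε ε'
      have := min_le_right ε ε'
      dsimp only at *
      rcases lt_or_ge z d with hzd | hzd
      · exact Or.inl ⟨⟨by linarith, by linarith⟩, hz, hzd⟩
      · exact Or.inr ⟨⟨by linarith, by linarith⟩, by dsimp; linarith, hz'⟩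
    · intro t
      obtain ⟨T, hT, H⟩ := h.exists_isGermSection_nhds (Set.mem_univ (x, t))
      obtain ⟨ε, hε, hball⟩ := Metric.mem_nhds_iff.1 hT
      refine ⟨ε, hε, ε, hε, hmono ?_ H⟩
      rwa [← Real.ball_eq_Ioo, ← Real.ball_eq_Ioo, ball_prod_same]
  refine interval_induction (Q := fun a b =>
    ∃ F, IsGermSection ρ (Set.Ioo a b ×ˢ Set.Ioo c d) F) ?_ ?_ (fun x => strip x c d) a b
  · intro a b a' b' ha hb H
    exact hmono (Set.prod_mono (Set.Ioo_subset_Ioo ha hb) le_rfl) H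
  · intro a b a' b' hab H H'
    refine hglue H H' ?_
    rintro ⟨y, z⟩ ⟨⟨hy, hy'⟩, hz⟩
    dsimp only at *
    rcases lt_or_ge y b with hyb | hyb
    · exact Or.inl ⟨⟨hy, hyb⟩, hz⟩
    · exact Or.inr ⟨⟨by dsimp; linarith, hy'⟩, hz⟩

theorem CompatibleGerms.exists_isGermSection_plane (h : CompatibleGerms ρ Set.univ) :
    ∃ F, IsGermSection ρ Set.univ F := by
  let K : ℕ → Set (ℝ × ℝ) := fun n =>
    Set.Ioo (-(n + 1 : ℝ)) (n + 1) ×ˢ Set.Ioo (-(n + 1 : ℝ)) (n + 1)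
  have hKo : ∀ n, IsOpen (K n) := fun n => isOpen_Ioo.prod isOpen_Ioo
  choose F hF using fun n : ℕ => h.exists_isGermSection_box (-(n + 1 : ℝ)) (n + 1) (-(n + 1 : ℝ))
    (n + 1)
  have h0 : ∀ n, (0 : ℝ × ℝ) ∈ K n := fun n => by
    have : (0 : ℝ) < n + 1 := by positivity
    exact ⟨⟨neg_lt_zero.2 this, this⟩, neg_lt_zero.2 this, this⟩
  let N : ℝ × ℝ → ℕ := fun x => ⌈|x.1| + |x.2|⌉₊
  have hN : ∀ x, x ∈ K (N x) := fun x => by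
    have h1 := Nat.le_ceil (|x.1| + |x.2|)
    have h2 := abs_nonneg x.1
    have h3 := abs_nonneg x.2
    exact ⟨abs_lt.1 (by dsimp only [N]; linarith), abs_lt.1 (by dsimp only [N]; linarith)⟩
  -- All boxes contain the origin and meet in connected sets, so dividing by the value at the origin
  -- makes their sections agree.
  have key : ∀ m n, ∀ x ∈ K m ∩ K n, (F m 0)⁻¹ * F m x = (F n 0)⁻¹ * F n x := by
    intro m n x hx
    have := (isPreconnected_box_inter _ _ _ _ _ _ _ _).apply_eq_of_eventually_eq
      (f := fun y => F m y * (F n y)⁻¹) (fun y hy => (hF m).eventually_eq (hF n) hy) hx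
      ⟨h0 m, h0 n⟩
    rw [mul_inv_eq_iff_eq_mul] at this
    rw [this, mul_assoc, inv_mul_cancel_left]
  refine ⟨fun x => (F (N x) 0)⁻¹ * F (N x) x, fun x _ => ?_⟩
  obtain ⟨c, hc⟩ := hF (N x) x (hN x)
  refine ⟨(F (N x) 0)⁻¹ * c, ?_⟩
  filter_upwards [hc, (hKo (N x)).mem_nhds (hN x)] with y hy hyK
  rw [key _ (N x) y ⟨hN y, hyK⟩, hy, mul_assoc]

end plane

/-- A compatible family of germs has a section on any open set that is homeomorphic to the plane. -/
theorem CompatibleGerms.exists_isGermSection {X : Type u} [TopologicalSpace X] {A : Type v}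
    [CommGroup A] {ρ : X → X → A} {S : Set X} (h : CompatibleGerms ρ S)
    (φ : ℝ × ℝ → X) (ψ : X → ℝ × ℝ) (hφ : Continuous φ) (hφS : ∀ y, φ y ∈ S)
    (hψ : ∀ x ∈ S, ContinuousAt ψ x) (hS : IsOpen S) (hφψ : ∀ x ∈ S, φ (ψ x) = x) :
    ∃ F, IsGermSection ρ S F := by
  have h' : CompatibleGerms (fun y z => ρ (φ y) (φ z)) Set.univ := by
    intro y _
    filter_upwards [hφ.continuousAt.eventually (h (φ y) (hφS y))] with z ⟨c, hc⟩
    exact ⟨c, hφ.continuousAt.eventually hc⟩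
  obtain ⟨F, hF⟩ := h'.exists_isGermSection_plane
  refine ⟨F ∘ ψ, fun x hx => ?_⟩
  obtain ⟨c, hc⟩ := hF (ψ x) trivial
  refine ⟨c, ?_⟩
  filter_upwards [(hψ x hx).eventually hc, hS.mem_nhds hx] with y hy hyS
  rw [Function.comp_apply, hy, hφψ x hx, hφψ y hyS]

/-! ### The projective line as the unit sphere -/

namespace CP1

theorem coord_mk (a : Fin 2 → ℂ) (ha : a ≠ 0) : coord (Projectivization.mk ℂ a ha) = sphereVec a :=
  rfl

/-- The coordinates determine `|a₁|² / |a|²` and `a₀ ā₁ / |a|²`; their quotient is `a₀ / a₁` unless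
`a₁ = 0`, which is the single point at infinity. -/
theorem coord_injective : Function.Injective coord := by
  intro p q h
  induction p using Projectivization.ind with | h a ha => ?_
  induction q using Projectivization.ind with | h b hb => ?_
  rw [coord_mk, coord_mk] at h
  have hA := normSq_pos ha
  have hB := normSq_pos hb
  set A := Complex.normSq (a 0) + Complex.normSq (a 1) with hAdef
  set B := Complex.normSq (b 0) + Complex.normSq (b 1) with hBdef
  have h0 : Complex.normSq (a 1) / A = Complex.normSq (b 1) / B := by
    have h0 : (Complex.normSq (a 1) - Complex.normSq (a 0)) / A =
        (Complex.normSq (b 1) - Complex.normSq (b 0)) / B := congrFun h 0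
    have e1 : Complex.normSq (a 0) = A - Complex.normSq (a 1) := by rw [hAdef]; ring
    have e2 : Complex.normSq (b 0) = B - Complex.normSq (b 1) := by rw [hBdef]; ring
    rw [e1, e2] at h0
    field_simp at h0 ⊢
    linarith
  have h1 : a 0 * star (a 1) / (A : ℂ) = b 0 * star (b 1) / (B : ℂ) := by
    have h1 : 2 * (a 0 * star (a 1)).re / A = 2 * (b 0 * star (b 1)).re / B := congrFun h 1
    have h2 : 2 * (a 0 * star (a 1)).im / A = 2 * (b 0 * star (b 1)).im / B := congrFun h 2
    apply Complex.ext
    · rw [Complex.div_ofReal_re, Complex.div_ofReal_re]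
      rw [mul_div_assoc, mul_div_assoc] at h1
      linarith
    · rw [Complex.div_ofReal_im, Complex.div_ofReal_im]
      rw [mul_div_assoc, mul_div_assoc] at h2
      linarith
  have hA' : (A : ℂ) ≠ 0 := Complex.ofReal_ne_zero.2 hA.ne'
  have hB' : (B : ℂ) ≠ 0 := Complex.ofReal_ne_zero.2 hB.ne'
  rw [Projectivization.mk_eq_mk_iff']
  have hz : a 1 = 0 ↔ b 1 = 0 := by
    rw [← Complex.normSq_eq_zero, ← Complex.normSq_eq_zero (z := b 1)]
    constructor <;> intro h <;> rw [h] at h0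
    · rw [zero_div, eq_comm, div_eq_zero_iff] at h0
      exact h0.resolve_right hB.ne'
    · rw [zero_div, div_eq_zero_iff] at h0
      exact h0.resolve_right hA.ne'
  by_cases ha1 : a 1 = 0
  · have hb1 := hz.1 ha1
    have hb0 : b 0 ≠ 0 := by
      intro h
      exact hb (by ext i; fin_cases i <;> simp [h, hb1])
    refine ⟨a 0 / b 0, ?_⟩
    ext i
    fin_cases i
    · simp [hb0]
    · simp [ha1, hb1]
  · have hb1 : b 1 ≠ 0 := fun h => ha1 (hz.2 h)
    refine ⟨a 1 / b 1, ?_⟩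
    have key : a 0 * b 1 = b 0 * a 1 := by
      have h0' : a 1 * star (a 1) / (A : ℂ) = b 1 * star (b 1) / (B : ℂ) := by
        rw [Complex.star_def, Complex.mul_conj, Complex.mul_conj]
        exact_mod_cast h0
      have hs : star (a 1) ≠ 0 := star_ne_zero.2 ha1
      have hs' : star (b 1) ≠ 0 := star_ne_zero.2 hb1
      rw [div_eq_div_iff hA' hB'] at h0' h1
      apply mul_right_cancel₀ (mul_ne_zero (mul_ne_zero hs hs') (mul_ne_zero hA' hB'))
      calc a 0 * b 1 * (star (a 1) * star (b 1) * (A * B))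
          = (a 0 * star (a 1) * B) * (b 1 * star (b 1) * A) := by ring
        _ = (b 0 * star (b 1) * A) * (a 1 * star (a 1) * B) := by rw [h1, h0']
        _ = _ := by ring
    ext i
    fin_cases i
    · simp only [Fin.zero_eta, Pi.smul_apply, smul_eq_mul]
      rw [div_mul_eq_mul_div, div_eq_iff hb1, key, mul_comm]
    · simp [hb1]

theorem sum_coord_sq (p : CP1) : coord p 0 ^ 2 + coord p 1 ^ 2 + coord p 2 ^ 2 = 1 := by
  induction p using Projectivization.ind with | h a ha => ?_
  rw [coord_mk]
  have hn := normSq_pos ha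
  have e : (a 0 * star (a 1)).re ^ 2 + (a 0 * star (a 1)).im ^ 2 =
      Complex.normSq (a 0) * Complex.normSq (a 1) := by
    rw [← Complex.normSq_conj (a 1), ← Complex.normSq_mul, Complex.normSq_apply, sq, sq]
    rfl
  simp only [sphereVec, Matrix.cons_val_zero, Matrix.cons_val_one, Matrix.cons_val]
  rw [div_pow, div_pow, div_pow, ← add_div, ← add_div, div_eq_one_iff_eq (by positivity)]
  linear_combination 4 * e

theorem exists_coord_eq {y : Fin 3 → ℝ} (hy : y 0 ^ 2 + y 1 ^ 2 + y 2 ^ 2 = 1) :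
    ∃ p, coord p = y := by
  -- Inverse stereographic projection is `ζ = (y₁ + i y₂) / (1 + y₀)`; it breaks down only at `y₀ =
  -- -1`, the point `ζ = ∞`.
  by_cases h : 1 + y 0 = 0
  · have h0 : y 0 = -1 := by linarith
    have h1 : y 1 = 0 := by nlinarith [sq_nonneg (y 1), sq_nonneg (y 2)]
    have h2 : y 2 = 0 := by nlinarith [sq_nonneg (y 1), sq_nonneg (y 2)]
    refine ⟨Projectivization.mk ℂ ![1, 0] (by simp), ?_⟩
    rw [coord_mk]
    ext i
    fin_cases i <;> simp [sphereVec, h0, h1, h2]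
  · refine ⟨Projectivization.mk ℂ ![⟨y 1, y 2⟩, ((1 + y 0 : ℝ) : ℂ)] ?_, ?_⟩
    · intro h'
      have := congrFun h' 1
      exact h (Complex.ofReal_eq_zero.1 this)
    rw [coord_mk]
    have e : y 1 * y 1 + y 2 * y 2 + (1 + y 0) * (1 + y 0) = 2 * (1 + y 0) := by
      linear_combination hy
    ext i
    fin_cases i <;>
      simp only [sphereVec, Complex.star_def, Complex.conj_ofReal, Complex.normSq_mk,
        Complex.normSq_ofReal, Matrix.cons_val_zero, Matrix.cons_val_one, Matrix.cons_val, e,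
        Complex.re_mul_ofReal, Complex.im_mul_ofReal, Fin.zero_eta, Fin.mk_one, Fin.reduceFinMk] <;>
      field_simp
    linear_combination -hy

theorem continuous_mk' : Continuous (Projectivization.mk' ℂ : {a : Fin 2 → ℂ // a ≠ 0} → CP1) :=
  continuous_coinduced_rng

instance : CompactSpace CP1 := by
  have : CompactSpace (Metric.sphere (0 : Fin 2 → ℂ) 1) :=
    isCompact_iff_compactSpace.1 (isCompact_sphere _ _)
  let f : Metric.sphere (0 : Fin 2 → ℂ) 1 → CP1 := fun a =>
    Projectivization.mk' ℂ ⟨a.1, ne_zero_of_mem_unit_sphere a⟩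
  have hf : Continuous f := continuous_mk'.comp (Continuous.subtype_mk continuous_subtype_val _)
  suffices h : Function.Surjective f from h.compactSpace hf
  intro p
  induction p using Projectivization.ind with | h a ha => ?_
  have hn : ‖a‖ ≠ 0 := norm_ne_zero_iff.2 ha
  refine ⟨⟨(‖a‖ : ℂ)⁻¹ • a, by simp [norm_smul, hn]⟩, ?_⟩
  change Projectivization.mk ℂ _ _ = _
  rw [Projectivization.mk_eq_mk_iff']
  exact ⟨_, rfl⟩

/-- A continuous injection from a compact space to a Hausdorff space is an embedding. Continuity of
maps into `CP1` can thus be tested in coordinates. -/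
theorem isInducing_coord : Topology.IsInducing coord :=
  (continuous_coord.isClosedEmbedding coord_injective).isInducing

/-- The Euclidean norm on `ℝ³`. -/
noncomputable def radius (y : Fin 3 → ℝ) : ℝ := √(y 0 ^ 2 + y 1 ^ 2 + y 2 ^ 2)

theorem radius_pos {y : Fin 3 → ℝ} (hy : y ≠ 0) : 0 < radius y := by
  refine Real.sqrt_pos.2 ?_
  by_contra h
  apply hy
  ext i
  fin_cases i <;> simp only [Fin.zero_eta, Fin.mk_one, Fin.reduceFinMk, Pi.zero_apply] <;>
    nlinarith [sq_nonneg (y 0), sq_nonneg (y 1), sq_nonneg (y 2)]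

theorem continuous_radius : Continuous radius := by
  unfold radius
  fun_prop

/-- The central projection of `ℝ³ ∖ {0}` to the sphere, as a map to the projective line. -/
noncomputable def ofVec (y : Fin 3 → ℝ) : CP1 :=
  Function.invFun coord ((radius y)⁻¹ • y)

theorem coord_ofVec {y : Fin 3 → ℝ} (hy : y ≠ 0) : coord (ofVec y) = (radius y)⁻¹ • y := by
  refine Function.invFun_eq (exists_coord_eq ?_)
  have h := radius_pos hy
  have e : radius y ^ 2 = y 0 ^ 2 + y 1 ^ 2 + y 2 ^ 2 := Real.sq_sqrt (by positivity)
  simp only [Pi.smul_apply, smul_eq_mul, mul_pow]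
  rw [← mul_add, ← mul_add, ← e, inv_pow, inv_mul_cancel₀ (by positivity)]

theorem coord_ne_zero (p : CP1) : coord p ≠ 0 := fun h => by
  obtain ⟨i, hi⟩ := exists_coord_ne_zero p
  exact hi (congrFun h i)

theorem ofVec_smul_coord {c : ℝ} (hc : 0 < c) (p : CP1) : ofVec (c • coord p) = p := by
  have hp := coord_ne_zero p
  apply coord_injective
  rw [coord_ofVec (smul_ne_zero hc.ne' hp), smul_smul]
  have : radius (c • coord p) = c := by
    unfold radius
    simp only [Pi.smul_apply, smul_eq_mul, mul_pow]
    rw [← mul_add, ← mul_add, sum_coord_sq, mul_one, Real.sqrt_sq hc.le]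
  rw [this, inv_mul_cancel₀ hc.ne', one_smul]

theorem continuousOn_ofVec : ContinuousOn ofVec {0}ᶜ := by
  rw [isInducing_coord.continuousOn_iff]
  refine ContinuousOn.congr (f := fun y => (radius y)⁻¹ • y) ?_ fun y hy => coord_ofVec hy
  exact (continuous_radius.continuousOn.inv₀ fun y hy => (radius_pos hy).ne').smul continuousOn_id

/-- The set is the image of the convex cone `C` under central projection to the sphere. -/
theorem isPreconnected_coord_preimage {C : Set (Fin 3 → ℝ)} (hC : Convex ℝ C) (h0 : (0 : _) ∉ C)
    (hsmul : ∀ c : ℝ, 0 < c → ∀ y ∈ C, c • y ∈ C) : IsPreconnected (coord ⁻¹' C) := by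
  have hne : ∀ y ∈ C, y ≠ 0 := fun y hy h => h0 (h ▸ hy)
  have : coord ⁻¹' C = ofVec '' C := by
    ext p
    constructor
    · intro hp
      exact ⟨coord p, hp, by simpa using ofVec_smul_coord one_pos p⟩
    · rintro ⟨y, hy, rfl⟩
      rw [Set.mem_preimage, coord_ofVec (hne y hy)]
      exact hsmul _ (inv_pos.2 (radius_pos (hne y hy))) y hy
  rw [this]
  exact hC.isPreconnected.image _ (continuousOn_ofVec.mono fun y hy => hne y hy)

theorem coord_equator (t : unitInterval) :
    coord (equator t) = ![Real.cos (2 * Real.pi * t), Real.sin (2 * Real.pi * t), 0] := by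
  change sphereVec ![(Real.sin (Real.pi * t) : ℂ), (Real.cos (Real.pi * t) : ℂ)] = _
  have h := Real.sin_sq_add_cos_sq (Real.pi * t)
  have h' : Real.sin (Real.pi * t) * Real.sin (Real.pi * t) +
    Real.cos (Real.pi * t) * Real.cos (Real.pi * t) = 1 := by linarith
  have e : 2 * Real.pi * (t : ℝ) = 2 * (Real.pi * t) := by ring
  rw [e, Real.cos_two_mul, Real.sin_two_mul]
  ext i
  fin_cases i <;>
    simp only [sphereVec, Complex.star_def, Complex.conj_ofReal, Complex.normSq_ofReal,
      Matrix.cons_val_zero, Matrix.cons_val_one, Matrix.cons_val, h', ← Complex.ofReal_mul,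
      Complex.ofReal_re, Complex.ofReal_im, div_one, Fin.zero_eta, Fin.mk_one, Fin.reduceFinMk]
  · linarith
  · ring
  · ring

end CP1

/-! ### Stars, faces and the equatorial band: connectedness and plane charts -/

namespace CP1

theorem mem_star {v : Fin 3 × ℤˣ} {p : CP1} :
    p ∈ octahedralCover.U v ↔ 0 < ((v.2 : ℤ) : ℝ) * coord p v.1 :=
  Iff.rfl

theorem sign_mul_self (ε : ℤˣ) : ((ε : ℤ) : ℝ) * ((ε : ℤ) : ℝ) = 1 := by
  rw [← Int.cast_mul, ← Units.val_mul, Int.units_mul_self]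
  simp

theorem isPreconnected_of_forall_pos {ι : Type*} [Nonempty ι] (L : ι → (Fin 3 → ℝ) →ₗ[ℝ] ℝ) :
    IsPreconnected {p | ∀ k, 0 < L k (coord p)} := by
  refine isPreconnected_coord_preimage (C := {y | ∀ k, 0 < L k y}) ?_ ?_ ?_
  · rw [Set.ofPred_forall]
    exact convex_iInter fun k => convex_halfSpace_gt (L k).isLinear 0
  · intro h
    obtain ⟨k⟩ := ‹Nonempty ι›
    simpa using h k
  · intro c hc y hy k
    rw [map_smul]
    exact mul_pos hc (hy k)

/-- The signed coordinate that is positive on the open star of the vertex `v`. -/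
def starForm (v : Fin 3 × ℤˣ) : (Fin 3 → ℝ) →ₗ[ℝ] ℝ := ((v.2 : ℤ) : ℝ) • LinearMap.proj v.1

theorem mem_star_iff {v : Fin 3 × ℤˣ} {p : CP1} :
    p ∈ octahedralCover.U v ↔ 0 < starForm v (coord p) :=
  Iff.rfl

theorem isPreconnected_star_inter (v w : Fin 3 × ℤˣ) :
    IsPreconnected ((octahedralCover.U v ⊓ octahedralCover.U w : Opens CP1) : Set CP1) := by
  convert isPreconnected_of_forall_pos ![starForm v, starForm w] using 1
  ext p
  simp [Fin.forall_fin_two, mem_star_iff]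

theorem isPreconnected_openFace (ε : Fin 3 → ℤˣ) : IsPreconnected (openFace ε : Set CP1) := by
  convert isPreconnected_of_forall_pos fun i => starForm (i, ε i) using 1
  ext p
  simp [Fin.forall_fin_succ, mem_star_iff, openFace, and_assoc]

/-- The band `|x₂| < δ (|x₀| + |x₁|)` around the equator. -/
def band (δ : ℝ) : Opens CP1 where
  carrier := {p | |coord p 2| < δ * (|coord p 0| + |coord p 1|)}
  is_open' := by
    have c : ∀ i, Continuous fun p => coord p i := fun i =>
      (continuous_apply i).comp continuous_coord
    exact isOpen_lt (c 2).abs (continuous_const.mul ((c 0).abs.add (c 1).abs))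

/-- On the two stars `|x₀|` and `|x₁|` are linear forms, so the inequality defining the band becomes
a pair of linear ones and the set comes from a convex cone. This is why the band is measured by
`|x₀| + |x₁|`. -/
theorem isPreconnected_band_inter {δ : ℝ} {v w : Fin 3 × ℤˣ} (hv : v.1 ≠ 2) (hw : w.1 ≠ 2)
    (hvw : v.1 ≠ w.1) :
    IsPreconnected ((octahedralCover.U v ⊓ octahedralCover.U w ⊓ band δ : Opens CP1) :
      Set CP1) := by
  convert isPreconnected_of_forall_pos ![starForm v, starForm w,
    δ • (starForm v + starForm w) - LinearMap.proj 2,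
    δ • (starForm v + starForm w) + LinearMap.proj 2] using 1
  ext p
  have habs : ∀ u : Fin 3 × ℤˣ, 0 < starForm u (coord p) →
      |coord p u.1| = starForm u (coord p) := by
    intro u hu
    rw [← abs_of_pos hu]
    change _ = |((u.2 : ℤ) : ℝ) * _|
    rw [abs_mul]
    rcases Int.units_eq_one_or u.2 with h | h <;> simp [h]
  have hsum : |coord p 0| + |coord p 1| = |coord p v.1| + |coord p w.1| := by
    obtain ⟨i, ε⟩ := v
    obtain ⟨j, ε'⟩ := w
    fin_cases i <;> fin_cases j <;> simp_all
    all_goals exact add_comm _ _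
  simp only [Fin.forall_fin_succ, Opens.coe_inf, Set.mem_inter_iff, SetLike.mem_coe, mem_star_iff,
    Set.mem_ofPred_eq, Matrix.cons_val_zero, Matrix.cons_val_succ, IsEmpty.forall_iff, and_true,
    and_assoc, LinearMap.sub_apply, LinearMap.add_apply, LinearMap.smul_apply, smul_eq_mul,
    LinearMap.proj_apply]
  refine and_congr_right fun h₁ => and_congr_right fun h₂ => ?_
  change |coord p 2| < δ * (|coord p 0| + |coord p 1|) ↔ _
  rw [hsum, habs v h₁, habs w h₂, abs_lt]
  constructor
  · rintro ⟨h, h'⟩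
    exact ⟨by linarith, by linarith⟩
  · rintro ⟨h, h'⟩
    exact ⟨by linarith, by linarith⟩

/-- `u / (1 - |u|)` inverts the homeomorphism `y ↦ y / (1 + |y|)` from the line to `(-1, 1)`, used
to straighten the band. -/
theorem div_one_sub_abs_div {u : ℝ} (hu : |u| < 1) :
    u / (1 - |u|) / (1 + |u / (1 - |u|)|) = u := by
  have h : 0 < 1 - |u| := by linarith
  rw [abs_div, abs_of_pos h]
  field_simp
  ring

theorem fin_three_cases (i m : Fin 3) : m = i ∨ m = i + 1 ∨ m = i + 2 := by
  revert i m
  decide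

section germs

variable {A : Type v} [CommGroup A] {ρ : CP1 → CP1 → A}

theorem continuousAt_coord (i : Fin 3) (p : CP1) : ContinuousAt (fun p => coord p i) p :=
  ((continuous_apply i).comp continuous_coord).continuousAt

theorem exists_isGermSection_of_vec {S : Opens CP1} (h : CompatibleGerms ρ S)
    (g : ℝ × ℝ → Fin 3 → ℝ) (ψ : CP1 → ℝ × ℝ) (hg : Continuous g) (hg0 : ∀ y, g y ≠ 0)
    (hgS : ∀ y, ofVec (g y) ∈ S) (hψ : ∀ p ∈ S, ContinuousAt ψ p)
    (hgψ : ∀ p ∈ S, ∃ c : ℝ, 0 < c ∧ g (ψ p) = c • coord p) : ∃ F, IsGermSection ρ S F := by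
  refine h.exists_isGermSection (fun y => ofVec (g y)) ψ ?_ hgS hψ S.isOpen ?_
  · exact continuousOn_ofVec.comp_continuous hg hg0
  · intro p hp
    obtain ⟨c, hc, e⟩ := hgψ p hp
    rw [e, ofVec_smul_coord hc]

/-- Central projection to the plane `xᵢ = ε` identifies the open star with that plane. -/
theorem exists_isGermSection_star (v : Fin 3 × ℤˣ)
    (h : CompatibleGerms ρ (octahedralCover.U v : Set CP1)) :
    ∃ F, IsGermSection ρ (octahedralCover.U v : Set CP1) F := by
  obtain ⟨i, ε⟩ := v
  have hε := sign_mul_self ε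
  have hne : i + 1 ≠ i ∧ i + 2 ≠ i ∧ i + 2 ≠ i + 1 :=
    (by decide : ∀ i : Fin 3, i + 1 ≠ i ∧ i + 2 ≠ i ∧ i + 2 ≠ i + 1) i
  have hmem : ∀ {p}, p ∈ octahedralCover.U (i, ε) ↔ 0 < ((ε : ℤ) : ℝ) * coord p i := Iff.rfl
  set e : ℝ := ((ε : ℤ) : ℝ)
  have he0 : e ≠ 0 := left_ne_zero_of_mul_eq_one hε
  let g : ℝ × ℝ → Fin 3 → ℝ := fun y m => if m = i then e else if m = i + 1 then y.1 else y.2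
  have gi : ∀ y, g y i = e := fun y => if_pos rfl
  have g0 : ∀ y, g y ≠ 0 := fun y h => he0 ((gi y).symm.trans (congrFun h i))
  refine exists_isGermSection_of_vec h g
    (fun p => (coord p (i + 1) / (e * coord p i), coord p (i + 2) / (e * coord p i)))
    ?_ g0 ?_ ?_ ?_
  · refine continuous_pi fun m => ?_
    dsimp only [g]
    split_ifs <;> fun_prop
  · intro y
    rw [hmem, coord_ofVec (g0 y), Pi.smul_apply, smul_eq_mul, gi, mul_left_comm, hε, mul_one]
    exact inv_pos.2 (radius_pos (g0 y))
  · intro p hp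
    have h0 : e * coord p i ≠ 0 := (hmem.1 hp).ne'
    have hc := (continuousAt_coord i p).const_mul e
    exact ((continuousAt_coord (i + 1) p).div hc h0).prodMk
      ((continuousAt_coord (i + 2) p).div hc h0)
  · intro p hp
    have hp' := hmem.1 hp
    refine ⟨(e * coord p i)⁻¹, inv_pos.2 hp', ?_⟩
    ext m
    simp only [Pi.smul_apply, smul_eq_mul, g]
    rcases fin_three_cases i m with rfl | rfl | rfl
    · rw [if_pos rfl, eq_inv_mul_iff_mul_eq₀ hp'.ne', mul_right_comm, hε, one_mul]
    · rw [if_neg hne.1, if_pos rfl, div_eq_inv_mul]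
    · rw [if_neg hne.2.1, if_neg hne.2.2, div_eq_inv_mul]

/-- In the plane `xᵢ = ε` the other equatorial coordinate `y₁` is free and `x₂` fills an interval of
half-width `δ (1 + |y₁|)`, which is stretched to the whole line. -/
theorem exists_isGermSection_band {δ : ℝ} (hδ : 0 < δ) (v : Fin 3 × ℤˣ) (hv : v.1 ≠ 2)
    (h : CompatibleGerms ρ (octahedralCover.U v ⊓ band δ : Opens CP1)) :
    ∃ F, IsGermSection ρ (octahedralCover.U v ⊓ band δ : Opens CP1) F := by
  obtain ⟨i, ε⟩ := v
  have hε := sign_mul_self ε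
  replace hv : i ≠ 2 := hv
  -- In `Fin 3` the map `i ↦ 1 - i` exchanges `0` and `1`: it names the other equatorial axis.
  have hne : 1 - i ≠ i ∧ 1 - i ≠ 2 ∧ ∀ m, m = i ∨ m = 1 - i ∨ m = 2 :=
    (by decide : ∀ i : Fin 3, i ≠ 2 → 1 - i ≠ i ∧ 1 - i ≠ 2 ∧ ∀ m, m = i ∨ m = 1 - i ∨ m = 2) i hv
  have hmem : ∀ {p}, p ∈ octahedralCover.U (i, ε) ⊓ band δ ↔ 0 < ((ε : ℤ) : ℝ) * coord p i ∧
      |coord p 2| < δ * (|coord p i| + |coord p (1 - i)|) := by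
    intro p
    refine and_congr_right fun _ => ?_
    change |coord p 2| < δ * (|coord p 0| + |coord p 1|) ↔ _
    obtain rfl | rfl : i = 0 ∨ i = 1 := (by decide : ∀ i : Fin 3, i ≠ 2 → i = 0 ∨ i = 1) i hv
    · rfl
    · rw [add_comm]; rfl
  have he1 : |((ε : ℤ) : ℝ)| = 1 := by
    rcases Int.units_eq_one_or ε with h | h <;> simp [h]
  set e : ℝ := ((ε : ℤ) : ℝ)
  have he0 : e ≠ 0 := left_ne_zero_of_mul_eq_one hε
  let g : ℝ × ℝ → Fin 3 → ℝ := fun y m => if m = i then e else if m = 2 then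
    δ * (1 + |y.1|) * (y.2 / (1 + |y.2|)) else y.1
  have gi : ∀ y, g y i = e := fun y => if_pos rfl
  have g2 : ∀ y, g y 2 = δ * (1 + |y.1|) * (y.2 / (1 + |y.2|)) := fun y => by
    simp [g, hv.symm]
  have gj : ∀ y, g y (1 - i) = y.1 := fun y => by simp [g, hne.1, hne.2.1]
  have g0 : ∀ y, g y ≠ 0 := fun y h => he0 ((gi y).symm.trans (congrFun h i))
  have hpos : ∀ p ∈ octahedralCover.U (i, ε) ⊓ band δ, 0 < |coord p i| + |coord p (1 - i)| := by
    intro p hp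
    have := (abs_nonneg _).trans_lt (hmem.1 hp).2
    exact (mul_pos_iff_of_pos_left hδ).1 this
  have hlt : ∀ p ∈ octahedralCover.U (i, ε) ⊓ band δ,
      |coord p 2 / (δ * (|coord p i| + |coord p (1 - i)|))| < 1 := by
    intro p hp
    have h0 := mul_pos hδ (hpos p hp)
    rw [abs_div, abs_of_pos h0, div_lt_one h0]
    exact (hmem.1 hp).2
  refine exists_isGermSection_of_vec h g
    (fun p => (coord p (1 - i) / (e * coord p i),
      coord p 2 / (δ * (|coord p i| + |coord p (1 - i)|)) /
        (1 - |coord p 2 / (δ * (|coord p i| + |coord p (1 - i)|))|))) ?_ g0 ?_ ?_ ?_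
  · refine continuous_pi fun m => ?_
    dsimp only [g]
    have : ∀ y : ℝ × ℝ, 1 + |y.2| ≠ 0 := fun y => by positivity
    split_ifs
    · fun_prop
    · fun_prop (disch := assumption)
    · fun_prop
  · intro y
    have hr := inv_pos.2 (radius_pos (g0 y))
    rw [hmem, coord_ofVec (g0 y)]
    simp only [Pi.smul_apply, smul_eq_mul, gi, gj, g2]
    refine ⟨by rwa [mul_left_comm, hε, mul_one], ?_⟩
    rw [abs_mul, abs_mul (radius _)⁻¹, abs_mul (radius _)⁻¹ y.1, ← mul_add, mul_left_comm, he1]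
    refine mul_lt_mul_of_pos_left ?_ (abs_pos.2 hr.ne')
    have h1 : 0 < 1 + |y.1| := by positivity
    have h2 : 0 < 1 + |y.2| := by positivity
    rw [abs_mul, abs_mul, abs_of_pos hδ, abs_of_pos h1]
    refine mul_lt_of_lt_one_right (mul_pos hδ h1) ?_
    rw [abs_div, abs_of_pos h2, div_lt_one h2]
    linarith
  · intro p hp
    have h0 : e * coord p i ≠ 0 := (hmem.1 hp).1.ne'
    have h1 : δ * (|coord p i| + |coord p (1 - i)|) ≠ 0 := (mul_pos hδ (hpos p hp)).ne'
    have h2 : 1 - |coord p 2 / (δ * (|coord p i| + |coord p (1 - i)|))| ≠ 0 := by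
      have := hlt p hp
      linarith
    have hc := continuousAt_coord
    have c1 : ContinuousAt (fun p => coord p 2 / (δ * (|coord p i| + |coord p (1 - i)|))) p :=
      (hc 2 p).div (((hc i p).abs.add (hc (1 - i) p).abs).const_mul δ) h1
    exact ((hc (1 - i) p).div ((hc i p).const_mul e) h0).prodMk
      (c1.div (continuousAt_const.sub c1.abs) h2)
  · intro p hp
    have hp' := (hmem.1 hp).1
    refine ⟨(e * coord p i)⁻¹, inv_pos.2 hp', ?_⟩
    have habs : |coord p i| = e * coord p i := by
      rw [← abs_of_pos hp', abs_mul, he1, one_mul]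
    ext m
    rcases hne.2.2 m with rfl | rfl | rfl
    · rw [gi, Pi.smul_apply, smul_eq_mul, eq_inv_mul_iff_mul_eq₀ hp'.ne', mul_right_comm, hε,
        one_mul]
    · rw [gj, Pi.smul_apply, smul_eq_mul, div_eq_inv_mul]
    · have hu := hlt p hp
      have h0 := hpos p hp
      rw [g2, Pi.smul_apply, smul_eq_mul]
      dsimp only
      set u := coord p 2 / (δ * (|coord p i| + |coord p (1 - i)|)) with hu_def
      rw [div_one_sub_abs_div hu, hu_def, abs_div, abs_of_pos hp', ← habs]
      have h4 : 0 < |coord p i| := habs ▸ hp'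
      field_simp

end germs

/-- On the compact complement of `Up` the coordinate `x₂` attains a maximum, which is negative
because the northern hemisphere lies in `Up`; likewise in the south. -/
theorem exists_band_le {Up Um : Opens CP1} (hp : north ⊆ Up) (hm : south ⊆ Um) :
    ∃ δ > 0, ∀ p, (-(δ * (|coord p 0| + |coord p 1|)) < coord p 2 → p ∈ Up) ∧
      (coord p 2 < δ * (|coord p 0| + |coord p 1|) → p ∈ Um) := by
  have c : ∀ i, Continuous fun p => coord p i := fun i => (continuous_apply i).comp continuous_coord
  have key : ∀ (U : Opens CP1) (s : ℝ), {p | 0 ≤ s * coord p 2} ⊆ (U : Set CP1) →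
      ∃ m > 0, ∀ p, -m < s * coord p 2 → p ∈ U := by
    intro U s hU
    rcases (U : Set CP1)ᶜ.eq_empty_or_nonempty with h | h
    · refine ⟨1, one_pos, fun p _ => ?_⟩
      by_contra hp
      exact Set.notMem_empty p (h ▸ hp)
    · obtain ⟨q, hq, hmax⟩ := U.isOpen.isClosed_compl.isCompact.exists_isMaxOn h
        ((c 2).const_mul s).continuousOn
      refine ⟨-(s * coord q 2), ?_, fun p hp => ?_⟩
      · by_contra hn
        exact hq (hU (by simpa using hn))
      · by_contra hpU
        have : s * coord p 2 ≤ s * coord q 2 := hmax hpU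
        linarith
  obtain ⟨m, hm0, hmU⟩ := key Up 1 (fun p h => hp (by simpa [north] using h))
  obtain ⟨m', hm0', hmU'⟩ := key Um (-1) (fun p h => hm (by simpa [south] using h))
  have hle : ∀ p, |coord p 0| + |coord p 1| ≤ 2 := fun p => by
    have := sum_coord_sq p
    have h0 : |coord p 0| ≤ 1 := abs_le_one_iff_mul_self_le_one.2 (by nlinarith)
    have h1 : |coord p 1| ≤ 1 := abs_le_one_iff_mul_self_le_one.2 (by nlinarith)
    linarith
  -- The halving compensates for `|x₀| + |x₁| ≤ 2`.
  refine ⟨min m m' / 2, by positivity, fun p => ?_⟩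
  have h1 : min m m' / 2 * (|coord p 0| + |coord p 1|) ≤ min m m' := by
    have := mul_le_mul_of_nonneg_left (hle p) (show 0 ≤ min m m' / 2 by positivity)
    linarith
  have h2 := min_le_left m m'
  have h3 := min_le_right m m'
  exact ⟨fun h => hmU p (by linarith), fun h => hmU' p (by linarith)⟩

end CP1

/-! ### Descent of coboundaries from a refinement to the cover -/

section values

variable {X : Type u} [TopologicalSpace X] {A : Type v}

open Classical in
/-- A function on an open set, extended by `1`. -/
noncomputable def LocallyConstant.extendOne [One A] {V : Opens X} (g : LocallyConstant V A)
    (x : X) : A :=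
  if h : x ∈ V then g ⟨x, h⟩ else 1

theorem LocallyConstant.extendOne_apply [One A] {V : Opens X} (g : LocallyConstant V A) {x : X}
    (h : x ∈ V) : g.extendOne x = g ⟨x, h⟩ :=
  dif_pos h

theorem LocallyConstant.eventually_extendOne_eq [One A] {V : Opens X} (g : LocallyConstant V A)
    {x : X} (h : x ∈ V) : ∀ᶠ y in nhds x, g.extendOne y = g.extendOne x := by
  filter_upwards [g.eventually_apply_eq h, V.isOpen.mem_nhds h] with y hy hyV
  rw [g.extendOne_apply h, g.extendOne_apply hyV, hy hyV]

end values

namespace CechCocycle₂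

variable {X : Type u} [TopologicalSpace X] {A : Type v} [CommGroup A] {𝔘 : OpenCover X}
  (z : CechCocycle₂ 𝔘 A)

/-- The components of a cocycle as functions on the whole space. -/
noncomputable def val (i j k : 𝔘.ι) (x : X) : A := (z.γ i j k).extendOne x

theorem val_eq {i j k : 𝔘.ι} {x : X} (hi : x ∈ 𝔘.U i) (hj : x ∈ 𝔘.U j) (hk : x ∈ 𝔘.U k) :
    z.val i j k x = z.γ i j k ⟨x, ⟨hi, hj⟩, hk⟩ :=
  LocallyConstant.extendOne_apply _ _

theorem eventually_val_eq {i j k : 𝔘.ι} {x : X} (hi : x ∈ 𝔘.U i) (hj : x ∈ 𝔘.U j)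
    (hk : x ∈ 𝔘.U k) : ∀ᶠ y in nhds x, z.val i j k y = z.val i j k x :=
  LocallyConstant.eventually_extendOne_eq _ ⟨⟨hi, hj⟩, hk⟩

theorem val_cocycle {i j k l : 𝔘.ι} {x : X} (hi : x ∈ 𝔘.U i) (hj : x ∈ 𝔘.U j) (hk : x ∈ 𝔘.U k)
    (hl : x ∈ 𝔘.U l) :
    z.val j k l x * (z.val i k l x)⁻¹ * z.val i j l x * (z.val i j k x)⁻¹ = 1 := by
  rw [z.val_eq hj hk hl, z.val_eq hi hk hl, z.val_eq hi hj hl, z.val_eq hi hj hk]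
  exact z.cocycle i j k l x hi hj hk hl

end CechCocycle₂

namespace CechPair₂

section algebra

variable {B : Type v} [AddCommGroup B]

/-- Shows that `g` in `exists_cochain` is multiplicative in its two indices from the refinement.
This and similar identities are stated additively so that `abel` proves them. -/
theorem twist_aux {zacd zvcd zvad zvac zacd' zvcd' zvad' zvac' bcd bad bac : B}
    (h : zacd + -zvcd + zvad + -zvac = 0) (h' : zacd' + -zvcd' + zvad' + -zvac' = 0)
    (e : zacd = zacd' + (bcd + -bad + bac)) :
    zvad + -(zvad' + bad) = zvac + -(zvac' + bac) + (zvcd + -(zvcd' + bcd)) := by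
  linear_combination (norm := abel) h - h' - e

/-- Shows that replacing the auxiliary index `a y` by the fixed index `a x` removes the dependence
of `k` on the choice of `a y`. -/
theorem change_aux {c c' gv gw F G p p' q q' zva zwa zva' zwa' b : B}
    (hF : F = c + -gv) (hG : G = c' + -gw)
    (hv : gv = zva + -(zva' + b)) (hw : gw = zwa + -(zwa' + b))
    (h : zwa + -zva + q + -p = 0) (h' : zwa' + -zva' + q' + -p' = 0) :
    F + -G + (q + -q') = c + -c' + (p + -p') := by
  linear_combination (norm := abel) hF - hG - hv + hw + h - h'

theorem coboundary_aux {Fu Fv Fw vw uw uv vw' uw' uv' z z' : B}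
    (h : vw + -uw + uv + -z = 0) (h' : vw' + -uw' + uv' + -z' = 0) :
    z = z' + ((Fv + -Fw + (vw + -vw')) + -(Fu + -Fw + (uw + -uw')) +
      (Fu + -Fv + (uv + -uv'))) := by
  linear_combination (norm := abel) h' - h

end algebra

/-- If every member of the cover `𝔘` is simply connected, in the sense that compatible germs have
sections there, then cocycles on `𝔘` which become cohomologous on a refinement are cohomologous
on `𝔘`. -/
theorem Cohomologous.exists_cochain {X : Type u} [TopologicalSpace X] {A : Type v} [CommGroup A]
    {𝔘 : OpenCover X} (hU : ∀ v (ρ : X → X → A), CompatibleGerms ρ (𝔘.U v : Set X) →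
      ∃ F, IsGermSection ρ (𝔘.U v : Set X) F)
    {z z' : CechCocycle₂ 𝔘 A} (h : Cohomologous ⟨𝔘, z⟩ ⟨𝔘, z'⟩) :
    ∃ k : 𝔘.ι → 𝔘.ι → X → A,
      (∀ v w, ∀ x ∈ 𝔘.U v ⊓ 𝔘.U w, ∀ᶠ y in nhds x, k v w y = k v w x) ∧
      ∀ u v w x (hu : x ∈ 𝔘.U u) (hv : x ∈ 𝔘.U v) (hw : x ∈ 𝔘.U w),
        z.γ u v w ⟨x, ⟨hu, hv⟩, hw⟩ = z'.γ u v w ⟨x, ⟨hu, hv⟩, hw⟩ *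
          (k v w x * (k u w x)⁻¹ * k u v x) := by
  obtain ⟨𝔚, r, r', hr, hr', b, hb⟩ := h
  choose a ha using 𝔚.covers
  let β : 𝔚.ι → 𝔚.ι → X → A := fun c d => (b c d).extendOne
  have hβ : ∀ {c d e x}, x ∈ 𝔚.U c → x ∈ 𝔚.U d → x ∈ 𝔚.U e →
      z.val (r c) (r d) (r e) x =
        z'.val (r' c) (r' d) (r' e) x * (β d e x * (β c e x)⁻¹ * β c d x) := by
    intro c d e x hc hd he
    simp only [β]
    rw [z.val_eq (hr _ _ hc) (hr _ _ hd) (hr _ _ he),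
      LocallyConstant.extendOne_apply (b d e) ⟨hd, he⟩,
      z'.val_eq (hr' _ _ hc) (hr' _ _ hd) (hr' _ _ he),
      LocallyConstant.extendOne_apply (b c e) ⟨hc, he⟩,
      LocallyConstant.extendOne_apply (b c d) ⟨hc, hd⟩]
    exact hb c d e x hc hd he
  have β_ev : ∀ {c d x}, x ∈ 𝔚.U c → x ∈ 𝔚.U d → ∀ᶠ y in nhds x, β c d y = β c d x :=
    fun hc hd => LocallyConstant.eventually_extendOne_eq _ ⟨hc, hd⟩
  -- For fixed `v`, this is a 1-cocycle on `𝔘.U v` in the indices `c`, `d`. The hypothesis `hU`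
  -- trivializes it, as vanishing of the first cohomology of `𝔘.U v` would.
  let g : 𝔘.ι → 𝔚.ι → 𝔚.ι → X → A := fun v c d x =>
    z.val v (r c) (r d) x * (z'.val v (r' c) (r' d) x * β c d x)⁻¹
  have hg : ∀ {v c d e x}, x ∈ 𝔘.U v → x ∈ 𝔚.U c → x ∈ 𝔚.U d → x ∈ 𝔚.U e →
      g v c e x = g v c d x * g v d e x := by
    intro v c d e x hv hc hd he
    exact twist_aux (B := Additive A) (z.val_cocycle hv (hr _ _ hc) (hr _ _ hd) (hr _ _ he))
      (z'.val_cocycle hv (hr' _ _ hc) (hr' _ _ hd) (hr' _ _ he)) (hβ hc hd he)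
  have g_ev : ∀ {v c d x}, x ∈ 𝔘.U v → x ∈ 𝔚.U c → x ∈ 𝔚.U d →
      ∀ᶠ y in nhds x, g v c d y = g v c d x := by
    intro v c d x hv hc hd
    filter_upwards [z.eventually_val_eq hv (hr _ _ hc) (hr _ _ hd),
        z'.eventually_val_eq hv (hr' _ _ hc) (hr' _ _ hd),
      β_ev hc hd] with y h₁ h₂ h₃
    simp only [g, h₁, h₂, h₃]
  have hcompat : ∀ v, CompatibleGerms (fun x y => (g v (a x) (a y) y)⁻¹) (𝔘.U v : Set X) := by
    intro v x hx
    filter_upwards [(𝔘.U v).isOpen.mem_nhds hx, (𝔚.U (a x)).isOpen.mem_nhds (ha x)] with y hy hya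
    refine ⟨g v (a x) (a y) y, ?_⟩
    filter_upwards [g_ev hy hya (ha y), (𝔘.U v).isOpen.mem_nhds hy,
      (𝔚.U (a x)).isOpen.mem_nhds hya, (𝔚.U (a y)).isOpen.mem_nhds (ha y)] with t ht htv htx hty
    rw [← ht, hg htv htx hty (ha t), mul_inv (g v (a x) (a y) t), mul_inv_cancel_left]
  choose F hF using fun v => hU v _ (hcompat v)
  -- In the coboundary of `k` the factors `F` cancel, and the cocycle conditions with fourth index
  -- `r (a x)` or `r' (a x)` leave the quotient of `z` and `z'`.
  let k : 𝔘.ι → 𝔘.ι → X → A := fun v w x => F v x * (F w x)⁻¹ *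
    (z.val v w (r (a x)) x * (z'.val v w (r' (a x)) x)⁻¹)
  refine ⟨k, fun v w x hx => ?_, fun u v w x hu hv hw => ?_⟩
  · obtain ⟨c, hc⟩ := hF v x hx.1
    obtain ⟨d, hd⟩ := hF w x hx.2
    have key : ∀ᶠ y in nhds x, k v w y = c * d⁻¹ *
        (z.val v w (r (a x)) x * (z'.val v w (r' (a x)) x)⁻¹) := by
      filter_upwards [hc, hd, (𝔘.U v).isOpen.mem_nhds hx.1, (𝔘.U w).isOpen.mem_nhds hx.2,
        (𝔚.U (a x)).isOpen.mem_nhds (ha x), z.eventually_val_eq hx.1 hx.2 (hr _ _ (ha x)),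
        z'.eventually_val_eq hx.1 hx.2 (hr' _ _ (ha x))] with y hcy hdy hyv hyw hya h₁ h₂
      rw [← h₁, ← h₂]
      exact change_aux (B := Additive A) hcy hdy rfl rfl
        (z.val_cocycle hyv hyw (hr _ _ hya) (hr _ _ (ha y)))
        (z'.val_cocycle hyv hyw (hr' _ _ hya) (hr' _ _ (ha y)))
    filter_upwards [key] with y hy
    rw [hy, key.self_of_nhds]
  · have h₁ := z.val_cocycle hu hv hw (hr _ _ (ha x))
    have h₂ := z'.val_cocycle hu hv hw (hr' _ _ (ha x))
    rw [← z.val_eq hu hv hw, ← z'.val_eq hu hv hw]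
    exact coboundary_aux (B := Additive A) h₁ h₂

end CechPair₂

/-! ### Evaluation on the fundamental cycle -/

namespace CP1

/-- The signed product over the faces of the octahedron. -/
def faceProd {A : Type v} [CommGroup A] (f : (Fin 3 → ℤˣ) → A) : A :=
  ∏ ε : Fin 3 → ℤˣ, f ε ^ ((∏ i, ε i : ℤˣ) : ℤ)

theorem faceProd_mul {A : Type v} [CommGroup A] (f g : (Fin 3 → ℤˣ) → A) :
    faceProd (fun ε => f ε * g ε) = faceProd f * faceProd g := by
  simp only [faceProd, mul_zpow, Finset.prod_mul_distrib]

theorem faceProd_inv {A : Type v} [CommGroup A] (f : (Fin 3 → ℤˣ) → A) :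
    faceProd (fun ε => (f ε)⁻¹) = (faceProd f)⁻¹ := by
  simp only [faceProd, inv_zpow, Finset.prod_inv_distrib]

/-- Flipping `ε i` pairs each face with its neighbour across the edge opposite to that vertex, and
reverses the exponent. -/
theorem faceProd_eq_one {A : Type v} [CommGroup A] (f : (Fin 3 → ℤˣ) → A) (i : Fin 3)
    (h : ∀ ε, f (Function.update ε i (-ε i)) = f ε) : faceProd f = 1 := by
  refine Finset.prod_involution (fun ε _ => Function.update ε i (-ε i)) ?_ ?_
    (fun _ _ => Finset.mem_univ _) ?_
  · intro ε _
    have : ∏ j, Function.update ε i (-ε i) j = -∏ j, ε j := by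
      rw [Finset.prod_update_of_mem (Finset.mem_univ i), neg_mul,
        ← Finset.mul_prod_erase Finset.univ ε (Finset.mem_univ i), Finset.sdiff_singleton_eq_erase]
    rw [h, this, Units.val_neg, zpow_neg, mul_inv_cancel]
  · intro ε _ _ he
    have := congrFun he i
    rw [Function.update_self] at this
    exact units_ne_neg_self _ this.symm
  · intro ε _
    simp

variable {A : Type v} [CommGroup A]

/-- Each factor of the coboundary ignores one of the three signs, so `faceProd_eq_one` removes it.
-/
theorem faceProd_congr_coboundary {f g : (Fin 3 → ℤˣ) → A} (c : Fin 3 × ℤˣ → Fin 3 × ℤˣ → A)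
    (h : ∀ ε, f ε = g ε * (c (1, ε 1) (2, ε 2) * (c (0, ε 0) (2, ε 2))⁻¹ * c (0, ε 0) (1, ε 1))) :
    faceProd f = faceProd g := by
  rw [funext h, faceProd_mul, faceProd_mul, faceProd_mul, faceProd_inv,
    faceProd_eq_one (fun ε => c (1, ε 1) (2, ε 2)) 0 (by simp),
    faceProd_eq_one (fun ε => c (0, ε 0) (2, ε 2)) 1 (by simp),
    faceProd_eq_one (fun ε => c (0, ε 0) (1, ε 1)) 2 (by simp)]
  simp

theorem _root_.CechCocycle₂.eq_on_openFace (z : CechCocycle₂ octahedralCover A) (ε : Fin 3 → ℤˣ)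
    (p q : openFace ε) :
    z.γ (0, ε 0) (1, ε 1) (2, ε 2) p = z.γ (0, ε 0) (1, ε 1) (2, ε 2) q := by
  have := (isPreconnected_openFace ε).apply_eq_of_eventually_eq
    (f := z.val (0, ε 0) (1, ε 1) (2, ε 2))
    (fun x hx => z.eventually_val_eq hx.1.1 hx.1.2 hx.2) p.2 q.2
  rwa [z.val_eq p.2.1.1 p.2.1.2 p.2.2, z.val_eq q.2.1.1 q.2.1.2 q.2.2] at this

/-- The value of a cohomology class on the fundamental cycle is well defined. -/
theorem IsValueOnFundamentalCycle.unique {c : CechH2 CP1 A} {a a' : A}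
    (h : IsValueOnFundamentalCycle c a) (h' : IsValueOnFundamentalCycle c a') : a = a' := by
  obtain ⟨z, p, rfl, rfl⟩ := h
  obtain ⟨z', p', hz, rfl⟩ := h'
  obtain ⟨k, hk, hzk⟩ := CechPair₂.Cohomologous.exists_cochain
    (fun v ρ => exists_isGermSection_star v) (Quotient.exact hz : CechPair₂.Cohomologous _ _)
  -- Stars overlap in connected sets, so the locally constant cochain is constant and depends on
  -- edges only.
  have hconst : ∀ v w : Fin 3 × ℤˣ, ∃ c : A, ∀ x ∈ octahedralCover.U v ⊓ octahedralCover.U w,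
      k v w x = c := by
    intro v w
    by_cases hne : ((octahedralCover.U v ⊓ octahedralCover.U w : Opens CP1) : Set CP1).Nonempty
    · obtain ⟨y, hy⟩ := hne
      exact ⟨k v w y, fun x hx =>
        (isPreconnected_star_inter v w).apply_eq_of_eventually_eq (hk v w) hx hy⟩
    · exact ⟨1, fun x hx => (hne ⟨x, hx⟩).elim⟩
  choose c hc using hconst
  have key : ∀ ε : Fin 3 → ℤˣ, z.γ (0, ε 0) (1, ε 1) (2, ε 2) (p ε) =
      z'.γ (0, ε 0) (1, ε 1) (2, ε 2) (p' ε) *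
      (c (1, ε 1) (2, ε 2) * (c (0, ε 0) (2, ε 2))⁻¹ * c (0, ε 0) (1, ε 1)) := by
    intro ε
    have hp := (p' ε).2
    rw [z.eq_on_openFace ε (p ε) (p' ε), ← hc (1, ε 1) (2, ε 2) (p' ε) ⟨hp.1.2, hp.2⟩,
      ← hc (0, ε 0) (2, ε 2) (p' ε) ⟨hp.1.1, hp.2⟩, ← hc (0, ε 0) (1, ε 1) (p' ε) hp.1]
    exact hzk _ _ _ _ hp.1.1 hp.1.2 hp.2
  exact faceProd_congr_coboundary c key

end CP1

/-! ### Uniqueness of the Giraud class -/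

namespace FlatU1Gerbe

variable {X : Type u} [TopologicalSpace X] (𝒢 : FlatU1Gerbe.{u, v, w} X)

theorem cocycle_iff_value {𝔘 : OpenCover X} (O : ∀ i, 𝒢.Obj (𝔘.U i))
    (σ : ∀ i j, 𝒢.res (V := 𝔘.U i ⊓ 𝔘.U j) inf_le_right (O j) ⟶ 𝒢.res inf_le_left (O i))
    {i j k : 𝔘.ι} (g : LocallyConstant ↥(𝔘.U i ⊓ 𝔘.U j ⊓ 𝔘.U k) Circle) :
    𝒢.resHom (V' := 𝔘.U i ⊓ 𝔘.U j ⊓ 𝔘.U k) (σ j k) (le_inf (inf_le_left.trans inf_le_right)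
          inf_le_right) ≫
        𝒢.resHom (σ i j) inf_le_left =
      𝒢.resHom (σ i k) (le_inf (inf_le_left.trans inf_le_left) inf_le_right) ≫ 𝒢.band _ g ↔
    ∀ x (hx : x ∈ 𝔘.U i ⊓ 𝔘.U j ⊓ 𝔘.U k), 𝒢.value (σ j k) x * 𝒢.value (σ i j) x =
      𝒢.value (σ i k) x * g ⟨x, hx⟩ := by
  have key : ∀ x (hx : x ∈ 𝔘.U i ⊓ 𝔘.U j ⊓ 𝔘.U k),
      𝒢.value (𝒢.resHom (V' := 𝔘.U i ⊓ 𝔘.U j ⊓ 𝔘.U k) (σ j k)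
        (le_inf (inf_le_left.trans inf_le_right) inf_le_right) ≫
          𝒢.resHom (σ i j) inf_le_left) x = 𝒢.value (σ j k) x * 𝒢.value (σ i j) x ∧
      𝒢.value (𝒢.resHom (V' := 𝔘.U i ⊓ 𝔘.U j ⊓ 𝔘.U k) (σ i k)
        (le_inf (inf_le_left.trans inf_le_left) inf_le_right) ≫ 𝒢.band _ g) x =
          𝒢.value (σ i k) x * g ⟨x, hx⟩ := by
    intro x hx
    rw [𝒢.value_comp _ _ hx, 𝒢.value_comp _ _ hx, 𝒢.value_resHom _ _ hx, 𝒢.value_resHom _ _ hx,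
      𝒢.value_resHom _ _ hx, 𝒢.value_band _ hx]
    exact ⟨rfl, rfl⟩
  constructor
  · intro h x hx
    rw [← (key x hx).1, ← (key x hx).2, h]
  · intro h
    refine 𝒢.value_ext fun x hx => ?_
    rw [(key x hx).1, (key x hx).2, h x hx]

theorem giraud_aux {B : Type v} [AddCommGroup B] {sbc sab sac g sbc' sab' sac' g' fa fb fc : B}
    (h : sbc + sab = sac + g) (h' : sbc' + sab' = sac' + g') :
    g = g' + ((sbc + fb + -(fc + sbc')) + -(sac + fa + -(fc + sac')) +
      (sab + fa + -(fb + sab'))) := by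
  linear_combination (norm := abel) h' - h

theorem IsGiraudClass.unique {c c' : CechH2 X Circle} (h : 𝒢.IsGiraudClass c)
    (h' : 𝒢.IsGiraudClass c') : c = c' := by
  obtain ⟨𝔘, z, O, σ, rfl, hσ⟩ := h
  obtain ⟨𝔘', z', O', σ', rfl, hσ'⟩ := h'
  choose i hi using 𝔘.covers
  choose i' hi' using 𝔘'.covers
  choose W k k' hW φ using fun x => 𝒢.exists_local_hom (O (i x)) (O' (i' x)) (hi x) (hi' x)
  let φ : ∀ x, 𝒢.res (k x) (O (i x)) ⟶ 𝒢.res (k' x) (O' (i' x)) := fun x => (φ x).some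
  -- Compares the two routes from `O (i c)` to `O' (i' a)`: by `σ` and then `φ a`, or by `φ c` and
  -- then `σ'`. Being a quotient of values of two such isomorphisms, it is locally constant.
  let β : X → X → X → Circle := fun a c => 𝒢.value (σ (i a) (i c)) * 𝒢.value (φ a) *
    (𝒢.value (φ c) * 𝒢.value (σ' (i' a) (i' c)))⁻¹
  refine Quotient.sound (s := ⟨_, CechPair₂.cohomologous_equivalence X Circle⟩) ?_
  refine ⟨⟨X, W, fun x => ⟨x, hW x⟩⟩, i, i', fun a x hx => k a hx, fun a x hx => k' a hx,
    fun a c => LocallyConstant.ofEventuallyEq _ (β a c) ?_, ?_⟩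
  · rintro x ⟨ha, hc⟩
    exact ((𝒢.parallel_value (φ c) hc).mul
      (𝒢.parallel_value (σ' (i' a) (i' c)) ⟨k' a ha, k' c hc⟩)).eventually_eq
      ((𝒢.parallel_value (σ (i a) (i c)) ⟨k a ha, k c hc⟩).mul (𝒢.parallel_value (φ a) ha))
  · intro a c d x ha hc hd
    have e := (𝒢.cocycle_iff_value O σ _).1 (hσ (i a) (i c) (i d)) x
      ⟨⟨k a ha, k c hc⟩, k d hd⟩
    have e' := (𝒢.cocycle_iff_value O' σ' _).1 (hσ' (i' a) (i' c) (i' d)) x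
      ⟨⟨k' a ha, k' c hc⟩, k' d hd⟩
    exact giraud_aux (B := Additive Circle) e e'

end FlatU1Gerbe

namespace FlatU1Gerbe

/-- Isomorphisms chosen separately near each point differ locally by constants, so they form
compatible germs, and a section of these germs is parallel. -/
theorem exists_parallel_on {X : Type u} [TopologicalSpace X] (𝒢 : FlatU1Gerbe.{u, v, w} X)
    {U₁ U₂ S : Opens X} (O : 𝒢.Obj U₁) (P : 𝒢.Obj U₂) (h₁ : S ≤ U₁) (h₂ : S ≤ U₂)
    (hS : ∀ ρ : X → X → Circle, CompatibleGerms ρ (S : Set X) →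
      ∃ F, IsGermSection ρ (S : Set X) F) :
    ∃ f, ∀ x ∈ S, 𝒢.Parallel O P f x := by
  classical
  have hex : ∀ x, ∃ f, x ∈ S → 𝒢.Parallel O P f x := fun x => by
    by_cases hx : x ∈ S
    · obtain ⟨f, hf⟩ := 𝒢.exists_parallel O P (h₁ hx) (h₂ hx)
      exact ⟨f, fun _ => hf⟩
    · exact ⟨1, fun h => (hx h).elim⟩
  choose ρ hρ using hex
  obtain ⟨F, hF⟩ := hS ρ (by
    intro x hx
    filter_upwards [(hρ x hx).eventually, S.isOpen.mem_nhds hx] with y hy hyS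
    refine ⟨ρ y y * (ρ x y)⁻¹, ?_⟩
    filter_upwards [hy.eventually_eq (hρ y hyS)] with z hz
    rw [← hz, inv_mul_cancel_right])
  refine ⟨F, fun x hx => ?_⟩
  obtain ⟨c, hc⟩ := hF x hx
  exact ((hρ x hx).const_mul c).congr (hc.mono fun y hy => hy.symm)

end FlatU1Gerbe

/-! ### The octahedral cocycle with prescribed value -/

namespace CP1

theorem eq_of_mem_star {v w : Fin 3 × ℤˣ} {x : CP1} (hv : x ∈ octahedralCover.U v)
    (hw : x ∈ octahedralCover.U w) (h : v.1 = w.1) : v = w := by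
  obtain ⟨i, ε⟩ := v
  obtain ⟨j, ε'⟩ := w
  obtain rfl : i = j := h
  rw [mem_star] at hv hw
  rcases Int.units_eq_one_or ε with rfl | rfl <;> rcases Int.units_eq_one_or ε' with rfl | rfl <;>
    first | rfl | (simp at hv hw; linarith)

/-- The transition constants between the sections over the pieces of the band, when the total
monodromy `h` is concentrated on the overlap of the stars of `-e₁` and `e₀`. -/
noncomputable def transition (h : Circle) (v w : Fin 3 × ℤˣ) : Circle :=
  if v = (0, 1) ∧ w = (1, -1) then h⁻¹ else if v = (1, -1) ∧ w = (0, 1) then h else 1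

variable (h : Circle)

theorem transition_self (v : Fin 3 × ℤˣ) : transition h v v = 1 := by
  have h₁ : ¬(v = (0, 1) ∧ v = (1, -1)) := by rintro ⟨rfl, h⟩; simp at h
  have h₂ : ¬(v = (1, -1) ∧ v = (0, 1)) := by rintro ⟨rfl, h⟩; simp at h
  rw [transition, if_neg h₁, if_neg h₂]

theorem transition_symm (v w : Fin 3 × ℤˣ) : transition h w v = (transition h v w)⁻¹ := by
  unfold transition
  by_cases h₁ : v = (0, 1) ∧ w = (1, -1)
  · obtain ⟨rfl, rfl⟩ := h₁
    simp
  · by_cases h₂ : v = (1, -1) ∧ w = (0, 1)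
    · obtain ⟨rfl, rfl⟩ := h₂
      simp
    · rw [if_neg h₁, if_neg h₂, if_neg (fun k => h₂ k.symm), if_neg (fun k => h₁ k.symm), inv_one]

theorem transition_of_left {v w : Fin 3 × ℤˣ} (hv : v.1 = 2) : transition h v w = 1 := by
  have h₁ : ¬(v = (0, 1) ∧ w = (1, -1)) := by rintro ⟨rfl, -⟩; simp at hv
  have h₂ : ¬(v = (1, -1) ∧ w = (0, 1)) := by rintro ⟨rfl, -⟩; simp at hv
  rw [transition, if_neg h₁, if_neg h₂]

theorem transition_of_right {v w : Fin 3 × ℤˣ} (hw : w.1 = 2) : transition h v w = 1 := by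
  rw [transition_symm, transition_of_left h hw, inv_one]

/-- There are only two equatorial axes and opposite stars are disjoint, so two of the three vertices
coincide. -/
theorem transition_cocycle {u v w : Fin 3 × ℤˣ} {x : CP1} (hu : x ∈ octahedralCover.U u)
    (hv : x ∈ octahedralCover.U v) (hw : x ∈ octahedralCover.U w) (hu2 : u.1 ≠ 2) (hv2 : v.1 ≠ 2)
    (hw2 : w.1 ≠ 2) : transition h v w * (transition h u w)⁻¹ * transition h u v = 1 := by
  have key : u.1 = v.1 ∨ v.1 = w.1 ∨ u.1 = w.1 :=
    (by decide : ∀ i j k : Fin 3, i ≠ 2 → j ≠ 2 → k ≠ 2 → i = j ∨ j = k ∨ i = k) _ _ _ hu2 hv2 hw2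
  rcases key with e | e | e
  · obtain rfl := eq_of_mem_star hu hv e
    rw [transition_self, mul_inv_cancel, mul_one]
  · obtain rfl := eq_of_mem_star hv hw e
    rw [transition_self, one_mul, inv_mul_cancel]
  · obtain rfl := eq_of_mem_star hu hw e
    rw [transition_self, inv_one, mul_one, transition_symm, inv_mul_cancel]

open Classical in
/-- The components of the octahedral cocycle with value `h` on the fundamental cycle. -/
noncomputable def cocycleConst (u v w : Fin 3 × ℤˣ) : Circle :=
  if u = (2, -1) ∨ v = (2, -1) ∨ w = (2, -1) then 1
  else transition h v w * (transition h u w)⁻¹ * transition h u v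

theorem cocycleConst_of_ne {u v w : Fin 3 × ℤˣ} (hu : u ≠ (2, -1)) (hv : v ≠ (2, -1))
    (hw : w ≠ (2, -1)) : cocycleConst h u v w =
      transition h v w * (transition h u w)⁻¹ * transition h u v :=
  if_neg (by rintro (h | h | h) <;> contradiction)

theorem fst_ne_two {v : Fin 3 × ℤˣ} (h₁ : v ≠ (2, 1)) (h₂ : v ≠ (2, -1)) : v.1 ≠ 2 := by
  obtain ⟨i, ε⟩ := v
  rintro rfl
  rcases Int.units_eq_one_or ε with rfl | rfl <;> contradiction

/-- Away from the north pole, either the south pole occurs and the constant is `1` by definition, or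
all vertices are equatorial and the transition constants form a cocycle. -/
theorem cocycleConst_eq_one {u v w : Fin 3 × ℤˣ} {x : CP1} (hu : x ∈ octahedralCover.U u)
    (hv : x ∈ octahedralCover.U v) (hw : x ∈ octahedralCover.U w) (hu1 : u ≠ (2, 1))
    (hv1 : v ≠ (2, 1)) (hw1 : w ≠ (2, 1)) : cocycleConst h u v w = 1 := by
  by_cases hn : u = (2, -1) ∨ v = (2, -1) ∨ w = (2, -1)
  · exact if_pos hn
  · simp only [not_or] at hn
    rw [cocycleConst_of_ne h hn.1 hn.2.1 hn.2.2]
    exact transition_cocycle h hu hv hw (fst_ne_two hu1 hn.1) (fst_ne_two hv1 hn.2.1)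
      (fst_ne_two hw1 hn.2.2)

theorem ne_of_mem_star {u v : Fin 3 × ℤˣ} {x : CP1} (hu : x ∈ octahedralCover.U u)
    (hv : x ∈ octahedralCover.U v) (h : u = (2, -1)) : v ≠ (2, 1) := by
  rintro rfl
  have := eq_of_mem_star hu hv (by rw [h])
  rw [h] at this
  simp at this

theorem coboundary_coboundary_aux {B : Type v} [AddCommGroup B] (ij ik il jk jl kl : B) :
    (kl + -jl + jk) + -(kl + -il + ik) + (jl + -il + ij) + -(jk + -ik + ij) = 0 := by
  abel

/-- An octahedral cocycle with value `h` on the fundamental cycle. -/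
noncomputable def octahedralCocycle : CechCocycle₂ octahedralCover Circle where
  γ u v w := LocallyConstant.const _ (cocycleConst h u v w)
  cocycle i j k l x hi hj hk hl := by
    change cocycleConst h j k l * (cocycleConst h i k l)⁻¹ * cocycleConst h i j l *
      (cocycleConst h i j k)⁻¹ = 1
    -- A point in the southern star is in no northern one, so all four factors are `1`. Without the
    -- south pole the components are a genuine coboundary of the transition constants.
    by_cases hn : i = (2, -1) ∨ j = (2, -1) ∨ k = (2, -1) ∨ l = (2, -1)
    · have key : ∀ v, x ∈ octahedralCover.U v → v ≠ (2, 1) := by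
        rcases hn with hn | hn | hn | hn
        · exact fun v hv => ne_of_mem_star hi hv hn
        · exact fun v hv => ne_of_mem_star hj hv hn
        · exact fun v hv => ne_of_mem_star hk hv hn
        · exact fun v hv => ne_of_mem_star hl hv hn
      have hi' := key i hi
      have hj' := key j hj
      have hk' := key k hk
      have hl' := key l hl
      rw [cocycleConst_eq_one h hj hk hl hj' hk' hl', cocycleConst_eq_one h hi hk hl hi' hk' hl',
        cocycleConst_eq_one h hi hj hl hi' hj' hl', cocycleConst_eq_one h hi hj hk hi' hj' hk']
      simp
    · simp only [not_or] at hn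
      obtain ⟨hi', hj', hk', hl'⟩ := hn
      rw [cocycleConst_of_ne h hj' hk' hl', cocycleConst_of_ne h hi' hk' hl',
        cocycleConst_of_ne h hi' hj' hl', cocycleConst_of_ne h hi' hj' hk']
      exact coboundary_coboundary_aux (B := Additive Circle) _ _ _ _ _ _

theorem exists_mem_openFace (ε : Fin 3 → ℤˣ) : ∃ p, p ∈ openFace ε := by
  let y : Fin 3 → ℝ := fun i => ((ε i : ℤ) : ℝ)
  have hy : ∀ i, ((ε i : ℤ) : ℝ) * y i = 1 := fun i => sign_mul_self _
  have h0 : y ≠ 0 := fun h => by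
    have := hy 0
    rw [h] at this
    simp at this
  have key : ∀ i, ofVec y ∈ octahedralCover.U (i, ε i) := fun i => by
    rw [mem_star, coord_ofVec h0, Pi.smul_apply, smul_eq_mul, mul_left_comm, hy, mul_one]
    exact inv_pos.2 (radius_pos h0)
  exact ⟨ofVec y, ⟨key 0, key 1⟩, key 2⟩

/-- Only the face `e₀, -e₁, e₂` contributes: its component is `h⁻¹` and its orientation sign is
`-1`. -/
theorem faceProd_cocycleConst :
    faceProd (fun ε => cocycleConst h (0, ε 0) (1, ε 1) (2, ε 2)) = h := by
  rw [faceProd, Finset.prod_eq_single ![1, -1, 1]]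
  · simp [Fin.prod_univ_three, cocycleConst, transition]
  · intro ε _ hε
    suffices h : cocycleConst h (0, ε 0) (1, ε 1) (2, ε 2) = 1 by rw [h, one_zpow]
    by_cases h2 : ε 2 = 1
    · have : ¬(ε 0 = 1 ∧ ε 1 = -1) := fun k => hε (by
        ext i
        fin_cases i <;> simp [k.1, k.2, h2])
      simp [cocycleConst, h2, transition, this]
    · have : ε 2 = -1 := (Int.units_eq_one_or _).resolve_left h2
      simp [cocycleConst, this]
  · simp

theorem isValueOnFundamentalCycle_octahedralCocycle :
    IsValueOnFundamentalCycle (octahedralCocycle h).cohomologyClass h := by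
  choose p hp using exists_mem_openFace
  exact ⟨octahedralCocycle h, fun ε => ⟨p ε, hp ε⟩, rfl, (faceProd_cocycleConst h).symm⟩

end CP1

/-! ### Sections over the band, and gluing data for the two hemispheres -/

namespace CP1

variable (𝒢 : FlatU1Gerbe.{0, v, w} CP1)

theorem exists_parallel_agree {U₁ U₂ : Opens CP1} (O : 𝒢.Obj U₁) (P : 𝒢.Obj U₂) {δ : ℝ}
    {v w : Fin 3 × ℤˣ} (hv : v.1 ≠ 2) (hw : w.1 ≠ 2) (hvw : v.1 ≠ w.1) {f g : CP1 → Circle}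
    (hf : ∀ x ∈ octahedralCover.U v ⊓ band δ, 𝒢.Parallel O P f x)
    (hg : ∀ x ∈ octahedralCover.U w ⊓ band δ, 𝒢.Parallel O P g x) :
    ∃ c : Circle, ∀ x ∈ octahedralCover.U v ⊓ octahedralCover.U w ⊓ band δ, g x = c * f x := by
  by_cases hne : ((octahedralCover.U v ⊓ octahedralCover.U w ⊓ band δ : Opens CP1) :
      Set CP1).Nonempty
  · obtain ⟨y, hy⟩ := hne
    refine ⟨g y * (f y)⁻¹, fun x hx => ?_⟩
    rw [← (isPreconnected_band_inter hv hw hvw).apply_eq_of_eventually_eq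
      (f := fun x => g x * (f x)⁻¹) (fun z hz => (hf z ⟨hz.1.1, hz.2⟩).eventually_eq
        (hg z ⟨hz.1.2, hz.2⟩)) hx hy, inv_mul_cancel_right]
  · exact ⟨1, fun x hx => (hne ⟨x, hx⟩).elim⟩

/-- Each new section is rescaled to continue the previous one round the equator; the mismatch when
the circle closes is `h`. -/
theorem exists_band_sections {Up Um : Opens CP1} (Op : 𝒢.Obj Up) (Om : 𝒢.Obj Um) {δ : ℝ}
    (hδ : 0 < δ) (hp : band δ ≤ Up) (hm : band δ ≤ Um) :
    ∃ (h : Circle) (t : Fin 3 × ℤˣ → CP1 → Circle),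
      (∀ v : Fin 3 × ℤˣ, v.1 ≠ 2 → ∀ x ∈ octahedralCover.U v ⊓ band δ, 𝒢.Parallel Om Op (t v) x) ∧
      ∀ v w : Fin 3 × ℤˣ, v.1 ≠ 2 → w.1 ≠ 2 → ∀ x ∈ octahedralCover.U v,
        x ∈ octahedralCover.U w → x ∈ band δ → t v x = transition h v w * t w x := by
  have hex : ∀ v : Fin 3 × ℤˣ, v.1 ≠ 2 → ∃ f, ∀ x ∈ octahedralCover.U v ⊓ band δ,
      𝒢.Parallel Om Op f x := fun v hv =>
    𝒢.exists_parallel_on Om Op (inf_le_right.trans hm) (inf_le_right.trans hp)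
      fun ρ => exists_isGermSection_band hδ v hv
  have hnext : ∀ v w : Fin 3 × ℤˣ, v.1 ≠ 2 → w.1 ≠ 2 → v.1 ≠ w.1 → ∀ f,
      (∀ x ∈ octahedralCover.U v ⊓ band δ, 𝒢.Parallel Om Op f x) →
      ∃ g, (∀ x ∈ octahedralCover.U w ⊓ band δ, 𝒢.Parallel Om Op g x) ∧
        ∀ x ∈ octahedralCover.U v, x ∈ octahedralCover.U w → x ∈ band δ → f x = g x := by
    intro v w hv hw hvw f hf
    obtain ⟨g, hg⟩ := hex w hw
    obtain ⟨c, hc⟩ := exists_parallel_agree 𝒢 Om Op hv hw hvw hf hg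
    refine ⟨fun x => c⁻¹ * g x, fun x hx => (hg x hx).const_mul c⁻¹, fun x hxv hxw hxb => ?_⟩
    dsimp only
    rw [hc x ⟨⟨hxv, hxw⟩, hxb⟩, inv_mul_cancel_left]
  obtain ⟨t₀, h₀⟩ := hex (0, 1) (by simp)
  obtain ⟨t₁, h₁, e₀₁⟩ := hnext (0, 1) (1, 1) (by simp) (by simp) (by simp) t₀ h₀
  obtain ⟨t₂, h₂, e₁₂⟩ := hnext (1, 1) (0, -1) (by simp) (by simp) (by simp) t₁ h₁
  obtain ⟨t₃, h₃, e₂₃⟩ := hnext (0, -1) (1, -1) (by simp) (by simp) (by simp) t₂ h₂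
  -- No rescaling is left here: `t₃ = h * t₀`, so transport in the direction of the equator
  -- multiplies by `h`.
  obtain ⟨h, e₀₃⟩ := exists_parallel_agree 𝒢 Om Op (v := (0, 1)) (w := (1, -1)) (by simp)
    (by simp) (by simp) h₀ h₃
  let t : Fin 3 × ℤˣ → CP1 → Circle := fun v =>
    if v.1 = 0 then (if v.2 = 1 then t₀ else t₂) else (if v.2 = 1 then t₁ else t₃)
  have hcases : ∀ v : Fin 3 × ℤˣ, v.1 ≠ 2 → v = (0, 1) ∨ v = (1, 1) ∨ v = (0, -1) ∨ v = (1, -1) :=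
    by decide
  have c₀ : t (0, 1) = t₀ := by simp [t]
  have c₁ : t (1, 1) = t₁ := by simp [t]
  have c₂ : t (0, -1) = t₂ := by simp [t]
  have c₃ : t (1, -1) = t₃ := by simp [t]
  refine ⟨h, t, fun v hv => ?_, ?_⟩
  · rcases hcases v hv with rfl | rfl | rfl | rfl
    · rwa [c₀]
    · rwa [c₁]
    · rwa [c₂]
    · rwa [c₃]
  have hsymm : ∀ v w : Fin 3 × ℤˣ, (∀ x ∈ octahedralCover.U v, x ∈ octahedralCover.U w →
      x ∈ band δ → t v x = transition h v w * t w x) → ∀ x ∈ octahedralCover.U w,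
      x ∈ octahedralCover.U v → x ∈ band δ → t w x = transition h w v * t v x := by
    intro v w H x hw hv hx
    rw [H x hv hw hx, transition_symm, inv_mul_cancel_left]
  have k₀₁ : ∀ x ∈ octahedralCover.U (0, 1), x ∈ octahedralCover.U (1, 1) → x ∈ band δ →
      t (0, 1) x = transition h (0, 1) (1, 1) * t (1, 1) x := fun x hv hw hx => by
    rw [c₀, c₁, e₀₁ x hv hw hx, transition, if_neg (by simp), if_neg (by simp), one_mul]
  have k₁₂ : ∀ x ∈ octahedralCover.U (1, 1), x ∈ octahedralCover.U (0, -1) → x ∈ band δ →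
      t (1, 1) x = transition h (1, 1) (0, -1) * t (0, -1) x := fun x hv hw hx => by
    rw [c₁, c₂, e₁₂ x hv hw hx, transition, if_neg (by simp), if_neg (by simp), one_mul]
  have k₂₃ : ∀ x ∈ octahedralCover.U (0, -1), x ∈ octahedralCover.U (1, -1) → x ∈ band δ →
      t (0, -1) x = transition h (0, -1) (1, -1) * t (1, -1) x := fun x hv hw hx => by
    rw [c₂, c₃, e₂₃ x hv hw hx, transition, if_neg (by simp), if_neg (by simp), one_mul]
  have k₀₃ : ∀ x ∈ octahedralCover.U (0, 1), x ∈ octahedralCover.U (1, -1) → x ∈ band δ →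
      t (0, 1) x = transition h (0, 1) (1, -1) * t (1, -1) x := fun x hv hw hx => by
    rw [c₀, c₃, e₀₃ x ⟨⟨hv, hw⟩, hx⟩, transition, if_pos ⟨rfl, rfl⟩, inv_mul_cancel_left]
  intro v w hv hw x hxv hxw hx
  by_cases hvw : v.1 = w.1
  · obtain rfl := eq_of_mem_star hxv hxw hvw
    rw [transition_self, one_mul]
  · rcases hcases v hv with rfl | rfl | rfl | rfl <;> rcases hcases w hw with rfl | rfl | rfl | rfl
    all_goals first
      | exact (hvw rfl).elim
      | exact k₀₁ x hxv hxw hx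
      | exact k₁₂ x hxv hxw hx
      | exact k₂₃ x hxv hxw hx
      | exact k₀₃ x hxv hxw hx
      | exact hsymm _ _ k₀₁ x hxv hxw hx
      | exact hsymm _ _ k₁₂ x hxv hxw hx
      | exact hsymm _ _ k₂₃ x hxv hxw hx
      | exact hsymm _ _ k₀₃ x hxv hxw hx

/-- The sign of a hemisphere: `true` is the northern one. -/
def hemisphereSign (s : Bool) : ℤˣ := if s then 1 else -1

/-- The enlarged hemispheres `± x₂ > - δ (|x₀| + |x₁|)`. -/
def hemisphere (δ : ℝ) (s : Bool) : Opens CP1 where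
  carrier := {p | -(δ * (|coord p 0| + |coord p 1|)) < ((hemisphereSign s : ℤ) : ℝ) * coord p 2}
  is_open' := by
    have c : ∀ i, Continuous fun p => coord p i := fun i =>
      (continuous_apply i).comp continuous_coord
    exact isOpen_lt (continuous_const.mul ((c 0).abs.add (c 1).abs)).neg
      (continuous_const.mul (c 2))

theorem mem_band_of_mem_hemisphere {δ : ℝ} {x : CP1} (h₁ : x ∈ hemisphere δ true)
    (h₂ : x ∈ hemisphere δ false) : x ∈ band δ := by
  change -(δ * (|coord x 0| + |coord x 1|)) < ((1 : ℤ) : ℝ) * coord x 2 at h₁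
  change -(δ * (|coord x 0| + |coord x 1|)) < ((-1 : ℤ) : ℝ) * coord x 2 at h₂
  simp only [Int.cast_one, one_mul, Int.cast_neg, neg_mul, neg_lt_neg_iff] at h₁ h₂
  exact abs_lt.2 ⟨h₁, h₂⟩

/-- The refinement of the octahedral cover by the enlarged hemispheres. -/
noncomputable def hemisphereCover (δ : ℝ) (hδ : 0 < δ) : OpenCover CP1 where
  -- The star of a pole is paired with its own hemisphere only; equatorial stars are paired with
  -- both.
  ι := {a : (Fin 3 × ℤˣ) × Bool // a.1.1 = 2 → a.1.2 = hemisphereSign a.2}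
  U a := octahedralCover.U a.1.1 ⊓ hemisphere δ a.1.2
  covers p := by
    have hnn : 0 ≤ δ * (|coord p 0| + |coord p 1|) := by positivity
    have hsgn : ∀ s : Bool, 0 < ((hemisphereSign s : ℤ) : ℝ) * coord p 2 → p ∈ hemisphere δ s :=
      fun s hs => lt_of_le_of_lt (neg_nonpos.2 hnn) hs
    obtain ⟨v, hv⟩ := octahedralCover.covers p
    by_cases h2 : v.1 = 2
    · obtain ⟨i, ε⟩ := v
      obtain rfl : i = 2 := h2
      obtain ⟨s, rfl⟩ : ∃ s, ε = hemisphereSign s := by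
        rcases Int.units_eq_one_or ε with rfl | rfl
        · exact ⟨true, rfl⟩
        · exact ⟨false, rfl⟩
      exact ⟨⟨((2, hemisphereSign s), s), fun _ => rfl⟩, hv, hsgn s hv⟩
    · have hpos : 0 < |coord p 0| + |coord p 1| := by
        have hv0 : coord p v.1 ≠ 0 := right_ne_zero_of_mul (mem_star.1 hv).ne'
        have : v.1 = 0 ∨ v.1 = 1 := (by decide : ∀ i : Fin 3, i ≠ 2 → i = 0 ∨ i = 1) _ h2
        rcases this with e | e <;> rw [e] at hv0
        · exact add_pos_of_pos_of_nonneg (abs_pos.2 hv0) (abs_nonneg _)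
        · exact add_pos_of_nonneg_of_pos (abs_nonneg _) (abs_pos.2 hv0)
      have hlt := mul_pos hδ hpos
      rcases le_total 0 (coord p 2) with h0 | h0
      · refine ⟨⟨(v, true), fun h => (h2 h).elim⟩, hv, ?_⟩
        change -(δ * (|coord p 0| + |coord p 1|)) < ((1 : ℤ) : ℝ) * coord p 2
        rw [Int.cast_one, one_mul]
        linarith
      · refine ⟨⟨(v, false), fun h => (h2 h).elim⟩, hv, ?_⟩
        change -(δ * (|coord p 0| + |coord p 1|)) < ((-1 : ℤ) : ℝ) * coord p 2
        rw [Int.cast_neg, Int.cast_one, neg_one_mul]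
        linarith

section hemisphereValue

variable (h : Circle) (t : Fin 3 × ℤˣ → CP1 → Circle)

/-- The one of two vertices that lies on the equator. -/
def equatorialVertex (v w : Fin 3 × ℤˣ) : Fin 3 × ℤˣ := if v.1 = 2 then w else v

/-- The values of the isomorphisms between the restrictions of the objects on the hemispheres. -/
noncomputable def hemisphereValue (a b : (Fin 3 × ℤˣ) × Bool) (x : CP1) : Circle :=
  match a.2, b.2 with
  -- The transition constants sit on the northern pieces only, matching `cocycleConst`, which is
  -- trivial at the south pole.
  | true, true => transition h a.1 b.1
  | false, false => 1
  | true, false => t (equatorialVertex a.1 b.1) x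
  | false, true => (t (equatorialVertex b.1 a.1) x)⁻¹

variable {h t} {δ : ℝ}

theorem ne_pole {hδ : 0 < δ} (a : (hemisphereCover δ hδ).ι) :
    (a.1.2 = true → a.1.1 ≠ (2, -1)) ∧ (a.1.2 = false → a.1.1 ≠ (2, 1)) := by
  obtain ⟨⟨v, s⟩, ha⟩ := a
  constructor
  · rintro h rfl
    have h : s = true := h
    subst h
    exact absurd (ha rfl) (by decide)
  · rintro h rfl
    have h : s = false := h
    subst h
    exact absurd (ha rfl) (by decide)

/-- Here the values are the transition constants times the coboundary of the function that is `1` on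
northern pieces and `t` on southern ones. -/
theorem hemisphereValue_eq_of_ne_south {hδ : 0 < δ} {x : CP1}
    (ht : ∀ v w : Fin 3 × ℤˣ, v.1 ≠ 2 → w.1 ≠ 2 → x ∈ octahedralCover.U v →
      x ∈ octahedralCover.U w → t v x = transition h v w * t w x)
    (a b : (hemisphereCover δ hδ).ι) (ha : x ∈ (hemisphereCover δ hδ).U a)
    (hb : x ∈ (hemisphereCover δ hδ).U b)
    (ha' : a.1.1 ≠ (2, -1)) (hb' : b.1.1 ≠ (2, -1)) :
    hemisphereValue h t a.1 b.1 x = transition h a.1.1 b.1.1 *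
      ((if b.1.2 then 1 else t b.1.1 x) * (if a.1.2 then 1 else t a.1.1 x)⁻¹) := by
  have hna := ne_pole a
  have hnb := ne_pole b
  have hxa := ha.1
  have hxb := hb.1
  obtain ⟨⟨v, s⟩, _⟩ := a
  obtain ⟨⟨w, s'⟩, _⟩ := b
  dsimp only at *
  cases s <;> cases s' <;> simp only [hemisphereValue, if_true, Bool.false_eq_true, if_false,
    mul_one, inv_one, one_mul, equatorialVertex]
  · have hv := fst_ne_two (hna.2 rfl) ha'
    have hw := fst_ne_two (hnb.2 rfl) hb'
    rw [← mul_assoc, ← ht v w hv hw hxa hxb, mul_inv_cancel]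
  · have hv := fst_ne_two (hna.2 rfl) ha'
    split_ifs with hw
    · rw [transition_of_right h hw, one_mul]
    · rw [ht v w hv hw hxa hxb, mul_inv, mul_inv_cancel_left]
  · have hw := fst_ne_two (hnb.2 rfl) hb'
    split_ifs with hv
    · rw [transition_of_left h hv, one_mul]
    · exact ht v w hv hw hxa hxb

/-- Here the values are a pure coboundary, of the function that is `t⁻¹` on northern pieces and `1`
on southern ones. -/
theorem hemisphereValue_eq_of_ne_north {hδ : 0 < δ} {x : CP1}
    (ht : ∀ v w : Fin 3 × ℤˣ, v.1 ≠ 2 → w.1 ≠ 2 → x ∈ octahedralCover.U v →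
      x ∈ octahedralCover.U w → t v x = transition h v w * t w x)
    (a b : (hemisphereCover δ hδ).ι) (ha : x ∈ (hemisphereCover δ hδ).U a)
    (hb : x ∈ (hemisphereCover δ hδ).U b)
    (ha' : a.1.1 ≠ (2, 1)) (hb' : b.1.1 ≠ (2, 1)) :
    hemisphereValue h t a.1 b.1 x =
      (if b.1.2 then (t b.1.1 x)⁻¹ else 1) * (if a.1.2 then (t a.1.1 x)⁻¹ else 1)⁻¹ := by
  have hna := ne_pole a
  have hnb := ne_pole b
  have hxa := ha.1
  have hxb := hb.1
  obtain ⟨⟨v, s⟩, _⟩ := a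
  obtain ⟨⟨w, s'⟩, _⟩ := b
  dsimp only at *
  cases s <;> cases s' <;> simp only [hemisphereValue, if_true, Bool.false_eq_true, if_false,
    mul_one, inv_one, one_mul, equatorialVertex, inv_inv]
  · have hw := fst_ne_two hb' (hnb.1 rfl)
    rw [if_neg hw]
  · have hv := fst_ne_two ha' (hna.1 rfl)
    rw [if_neg hv]
  · have hv := fst_ne_two ha' (hna.1 rfl)
    have hw := fst_ne_two hb' (hnb.1 rfl)
    rw [ht v w hv hw hxa hxb, mul_left_comm, inv_mul_cancel, mul_one]

theorem coboundary_aux₁ {B : Type v} [AddCommGroup B] (bc ac ab a b c : B) :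
    (bc + (c + -b)) + (ab + (b + -a)) = (ac + (c + -a)) + (bc + -ac + ab) := by
  abel

theorem coboundary_aux₂ {B : Type v} [AddCommGroup B] (a b c : B) :
    (c + -b) + (b + -a) = c + -a := by
  abel

/-- In the band, one of the two coboundary formulas applies, since stars of both poles never meet.
Off the band all pieces lie on one side: in the south everything is `1`, in the north the definition
of `cocycleConst` is the claim. -/
theorem hemisphereValue_cocycle {hδ : 0 < δ} {x : CP1}
    (ht : x ∈ band δ → ∀ v w : Fin 3 × ℤˣ, v.1 ≠ 2 → w.1 ≠ 2 → x ∈ octahedralCover.U v →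
      x ∈ octahedralCover.U w → t v x = transition h v w * t w x)
    (a b c : (hemisphereCover δ hδ).ι) (ha : x ∈ (hemisphereCover δ hδ).U a)
    (hb : x ∈ (hemisphereCover δ hδ).U b) (hc : x ∈ (hemisphereCover δ hδ).U c) :
    hemisphereValue h t b.1 c.1 x * hemisphereValue h t a.1 b.1 x =
      hemisphereValue h t a.1 c.1 x * cocycleConst h a.1.1 b.1.1 c.1.1 := by
  by_cases hx : x ∈ band δ
  · by_cases hn : a.1.1 = (2, -1) ∨ b.1.1 = (2, -1) ∨ c.1.1 = (2, -1)
    · have key : ∀ v, x ∈ octahedralCover.U v → v ≠ (2, 1) := by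
        rcases hn with hn | hn | hn
        · exact fun v hv => ne_of_mem_star ha.1 hv hn
        · exact fun v hv => ne_of_mem_star hb.1 hv hn
        · exact fun v hv => ne_of_mem_star hc.1 hv hn
      have ha' := key _ ha.1
      have hb' := key _ hb.1
      have hc' := key _ hc.1
      rw [hemisphereValue_eq_of_ne_north (ht hx) b c hb hc hb' hc',
        hemisphereValue_eq_of_ne_north (ht hx) a b ha hb ha' hb',
        hemisphereValue_eq_of_ne_north (ht hx) a c ha hc ha' hc',
        cocycleConst_eq_one h ha.1 hb.1 hc.1 ha' hb' hc', mul_one]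
      exact coboundary_aux₂ (B := Additive Circle) _ _ _
    · simp only [not_or] at hn
      obtain ⟨ha', hb', hc'⟩ := hn
      rw [hemisphereValue_eq_of_ne_south (ht hx) b c hb hc hb' hc',
        hemisphereValue_eq_of_ne_south (ht hx) a b ha hb ha' hb',
        hemisphereValue_eq_of_ne_south (ht hx) a c ha hc ha' hc', cocycleConst_of_ne h ha' hb' hc']
      exact coboundary_aux₁ (B := Additive Circle) _ _ _ _ _ _
  · have hside : ∀ a b : (hemisphereCover δ hδ).ι, x ∈ (hemisphereCover δ hδ).U a →
        x ∈ (hemisphereCover δ hδ).U b → a.1.2 = b.1.2 := by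
      rintro ⟨⟨v, s⟩, _⟩ ⟨⟨w, s'⟩, _⟩ ha hb
      cases s <;> cases s'
      · rfl
      · exact (hx (mem_band_of_mem_hemisphere hb.2 ha.2)).elim
      · exact (hx (mem_band_of_mem_hemisphere ha.2 hb.2)).elim
      · rfl
    have hab := hside a b ha hb
    have hac := hside a c ha hc
    have hna := ne_pole a
    have hnb := ne_pole b
    have hnc := ne_pole c
    cases hs : a.1.2 <;> rw [hs] at hab hac
    · rw [cocycleConst_eq_one h ha.1 hb.1 hc.1 (hna.2 hs) (hnb.2 hab.symm) (hnc.2 hac.symm)]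
      simp only [hemisphereValue, hs, ← hab, ← hac]
    · rw [cocycleConst_of_ne h (hna.1 hs) (hnb.1 hab.symm) (hnc.1 hac.symm)]
      simp only [hemisphereValue, hs, ← hab, ← hac]
      rw [mul_comm (transition h b.1.1 c.1.1) (transition h a.1.1 c.1.1)⁻¹, mul_assoc,
        mul_inv_cancel_left]

end hemisphereValue

end CP1

/-! ### Values of bundle sections and uniqueness of the holonomy -/

namespace FlatU1Gerbe

section quotientBundle

variable {X : Type u} [TopologicalSpace X] {𝒢 : FlatU1Gerbe.{u, v, w} X} {U V : Opens X}
  {P : 𝒢.Obj U} {O : 𝒢.Obj V}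

/-- The function that represents a section of the bundle `P ⊗ O⁻¹`. -/
noncomputable def sectionValue {T : Over (U ⊓ V)}
    (s : (𝒢.quotientBundle P O).sections.obj (op T)) : X → Circle :=
  𝒢.value (O := 𝒢.res inf_le_right O) (P := 𝒢.res inf_le_left P) (h₁ := leOfHom T.hom)
    (h₂ := leOfHom T.hom) s

theorem parallel_sectionValue {T : Over (U ⊓ V)}
    (s : (𝒢.quotientBundle P O).sections.obj (op T)) {x : X} (hx : x ∈ T.left) :
    𝒢.Parallel (𝒢.res inf_le_right O : 𝒢.Obj (U ⊓ V))
      (𝒢.res inf_le_left P : 𝒢.Obj (U ⊓ V)) (sectionValue s) x :=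
  𝒢.parallel_value (O := 𝒢.res inf_le_right O) (P := 𝒢.res inf_le_left P) (h₁ := leOfHom T.hom)
    (h₂ := leOfHom T.hom) s hx

theorem sectionValue_map {T T' : Over (U ⊓ V)} (f : T' ⟶ T)
    (s : (𝒢.quotientBundle P O).sections.obj (op T)) {x : X} (hx : x ∈ T'.left) :
    sectionValue ((𝒢.quotientBundle P O).sections.map f.op s) x = sectionValue s x :=
  𝒢.value_resHom (O := 𝒢.res inf_le_right O) (P := 𝒢.res inf_le_left P) (h₁ := leOfHom T.hom)
    (h₂ := leOfHom T.hom) s (leOfHom f.left) hx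

theorem sectionValue_smul {T : Over (U ⊓ V)} (g : LocallyConstant T.left Circle)
    (s : (𝒢.quotientBundle P O).sections.obj (op T)) {x : X} (hx : x ∈ T.left) :
    sectionValue (g • s) x = sectionValue s x * g ⟨x, hx⟩ := by
  refine (𝒢.value_comp (O := 𝒢.res inf_le_right O) (P := 𝒢.res inf_le_left P)
    (Q := 𝒢.res inf_le_left P) (h₁ := leOfHom T.hom)
    (h₂ := leOfHom T.hom) (h₃ := leOfHom T.hom) s (𝒢.band _ g) hx).trans ?_
  rw [𝒢.value_band g hx]
  rfl

theorem sectionValue_eq_of_sameGerm {T T' : Over (U ⊓ V)}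
    {s : (𝒢.quotientBundle P O).sections.obj (op T)}
    {s' : (𝒢.quotientBundle P O).sections.obj (op T')} {x : X}
    (h : (𝒢.quotientBundle P O).SameGerm s s' x) : sectionValue s x = sectionValue s' x := by
  obtain ⟨Z, f, f', hx, e⟩ := h
  rw [← sectionValue_map f s hx, e, sectionValue_map f' s' hx]

theorem sameGerm_of_eventually_eq {T T' : Over (U ⊓ V)}
    {s : (𝒢.quotientBundle P O).sections.obj (op T)}
    {s' : (𝒢.quotientBundle P O).sections.obj (op T')} {x : X} (hx : x ∈ T.left) (hx' : x ∈ T'.left)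
    (h : ∀ᶠ y in nhds x, sectionValue s y = sectionValue s' y) :
    (𝒢.quotientBundle P O).SameGerm s s' x := by
  obtain ⟨W, hW, hWo, hxW⟩ := eventually_nhds_iff.1 h
  let W' : Opens X := ⟨W, hWo⟩ ⊓ (T.left ⊓ T'.left)
  let Z : Over (U ⊓ V) := Over.mk (Y := W') (homOfLE (inf_le_right.trans
    (inf_le_left.trans (leOfHom T.hom))))
  let f : Z ⟶ T := Over.homMk (homOfLE (inf_le_right.trans inf_le_left))
  let f' : Z ⟶ T' := Over.homMk (homOfLE (inf_le_right.trans inf_le_right))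
  refine ⟨Z, f, f', ⟨hxW, hx, hx'⟩, ?_⟩
  refine 𝒢.value_ext (O := 𝒢.res inf_le_right O) (P := 𝒢.res inf_le_left P)
    (h₁ := leOfHom Z.hom) (h₂ := leOfHom Z.hom) fun y hy => ?_
  exact (sectionValue_map f s hy).trans ((hW y hy.1).trans (sectionValue_map f' s' hy).symm)

/-- The quotient of two parallel sections along the loop is locally constant on the interval;
comparing it at both ends gives `h = h'`. -/
theorem holonomy_unique {ℓ : C(unitInterval, X)} (hℓ : ℓ 0 = ℓ 1) {h h' : Circle}
    (H : (𝒢.quotientBundle P O).IsHolonomy ℓ h) (H' : (𝒢.quotientBundle P O).IsHolonomy ℓ h') :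
    h = h' := by
  obtain ⟨T, s, hT, hs, hs1⟩ := H
  obtain ⟨T', s', hT', hs', hs1'⟩ := H'
  have hT1 : ℓ 1 ∈ (T 0).left := hℓ ▸ hT 0
  have hT1' : ℓ 1 ∈ (T' 0).left := hℓ ▸ hT' 0
  have e : sectionValue (s 1) (ℓ 1) = sectionValue (s 0) (ℓ 1) * h :=
    (sectionValue_eq_of_sameGerm hs1).trans (sectionValue_smul _ _ hT1)
  have e' : sectionValue (s' 1) (ℓ 1) = sectionValue (s' 0) (ℓ 1) * h' :=
    (sectionValue_eq_of_sameGerm hs1').trans (sectionValue_smul _ _ hT1')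
  have key := isPreconnected_univ.apply_eq_of_eventually_eq
    (f := fun t => sectionValue (s t) (ℓ t) * (sectionValue (s' t) (ℓ t))⁻¹)
    (fun t _ => by
      filter_upwards [hs t, hs' t, ℓ.continuous.continuousAt.eventually
        ((parallel_sectionValue (s' t) (hT' t)).eventually_eq
          (parallel_sectionValue (s t) (hT t)))] with t' h₁ h₂ h₃
      rw [sectionValue_eq_of_sameGerm h₁, sectionValue_eq_of_sameGerm h₂, h₃])
    (Set.mem_univ 1) (Set.mem_univ 0)
  rw [e, e', hℓ, mul_inv, mul_mul_mul_comm] at key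
  have k2 := mul_eq_left.1 key
  exact mul_inv_eq_one.1 k2

end quotientBundle

end FlatU1Gerbe

/-! ### The octahedral cocycle represents the Giraud class -/

namespace CP1

variable (𝒢 : FlatU1Gerbe.{0, v, w} CP1)

theorem band_le_hemisphere (δ : ℝ) (s : Bool) : band δ ≤ hemisphere δ s := by
  intro x hx
  have hx : |coord x 2| < δ * (|coord x 0| + |coord x 1|) := hx
  rw [abs_lt] at hx
  cases s
  · change -(δ * (|coord x 0| + |coord x 1|)) < ((-1 : ℤ) : ℝ) * coord x 2
    rw [Int.cast_neg, Int.cast_one, neg_one_mul]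
    linarith
  · change -(δ * (|coord x 0| + |coord x 1|)) < ((1 : ℤ) : ℝ) * coord x 2
    rw [Int.cast_one, one_mul]
    exact hx.1

/-- The octahedral cocycle, pulled back to the cover refined by the hemispheres. -/
noncomputable def hemisphereCocycle (h : Circle) (δ : ℝ) (hδ : 0 < δ) :
    CechCocycle₂ (hemisphereCover δ hδ) Circle where
  γ a b c := LocallyConstant.const _ (cocycleConst h a.1.1 b.1.1 c.1.1)
  cocycle a b c d x ha hb hc hd :=
    (octahedralCocycle h).cocycle a.1.1 b.1.1 c.1.1 d.1.1 x ha.1 hb.1 hc.1 hd.1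

/-- The second cocycle is the pullback of the first along the refinement that forgets the
hemisphere, so the trivial cochain suffices. -/
theorem cohomologyClass_hemisphereCocycle (h : Circle) (δ : ℝ) (hδ : 0 < δ) :
    (octahedralCocycle h).cohomologyClass = (hemisphereCocycle h δ hδ).cohomologyClass := by
  refine Quotient.sound (s := ⟨_, CechPair₂.cohomologous_equivalence CP1 Circle⟩) ?_
  refine ⟨hemisphereCover δ hδ, fun a => a.1.1, id, fun a x hx => hx.1, fun a x hx => hx,
    fun a c => 1, fun a c d x ha hc hd => ?_⟩
  change cocycleConst h a.1.1 c.1.1 d.1.1 = cocycleConst h a.1.1 c.1.1 d.1.1 * (1 * 1⁻¹ * 1)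
  simp

theorem parallel_hemisphereValue {U : Bool → Opens CP1} (O : ∀ s, 𝒢.Obj (U s)) {δ : ℝ} (hδ : 0 < δ)
    (hU : ∀ s, hemisphere δ s ≤ U s) (h : Circle) {t : Fin 3 × ℤˣ → CP1 → Circle}
    (ht : ∀ v : Fin 3 × ℤˣ, v.1 ≠ 2 → ∀ x ∈ octahedralCover.U v ⊓ band δ,
      𝒢.Parallel (O false) (O true) (t v) x)
    (a b : (hemisphereCover δ hδ).ι) {x : CP1} (ha : x ∈ (hemisphereCover δ hδ).U a)
    (hb : x ∈ (hemisphereCover δ hδ).U b) :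
    𝒢.Parallel (O b.1.2) (O a.1.2) (hemisphereValue h t a.1 b.1) x := by
  have key : ∀ {v w : Fin 3 × ℤˣ}, x ∈ octahedralCover.U v → x ∈ octahedralCover.U w →
      x ∈ band δ → v ≠ (2, -1) → w ≠ (2, 1) →
      𝒢.Parallel (O false) (O true) (t (equatorialVertex v w)) x := by
    intro v w hv hw hx hv' hw'
    unfold equatorialVertex
    split_ifs with h2
    · have hv1 : v = (2, 1) := by
        by_contra hv1
        exact fst_ne_two hv1 hv' h2
      refine ht w (fun hw2 => hw' ?_) x ⟨hw, hx⟩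
      rw [← hv1]
      exact eq_of_mem_star hw hv (hw2.trans h2.symm)
    · exact ht v h2 x ⟨hv, hx⟩
  have hna := ne_pole a
  have hnb := ne_pole b
  obtain ⟨⟨v, s⟩, _⟩ := a
  obtain ⟨⟨w, s'⟩, _⟩ := b
  cases s <;> cases s'
  · exact FlatU1Gerbe.parallel_const _ (hU _ ha.2) _
  · exact (key hb.1 ha.1 (mem_band_of_mem_hemisphere hb.2 ha.2) (hnb.1 rfl) (hna.2 rfl)).inv
  · exact key ha.1 hb.1 (mem_band_of_mem_hemisphere ha.2 hb.2) (hna.1 rfl) (hnb.2 rfl)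
  · exact FlatU1Gerbe.parallel_const _ (hU _ ha.2) _

theorem conj_aux {B : Type v} [AddCommGroup B] {bc ab ac g a b c : B} (h : bc + ab = ac + g) :
    (-c + bc + b) + (-b + ab + a) = (-c + ac + a) + g := by
  linear_combination (norm := abel) h

theorem isGiraudClass_octahedralCocycle {U : Bool → Opens CP1} (O : ∀ s, 𝒢.Obj (U s)) {δ : ℝ}
    (hδ : 0 < δ) (hU : ∀ s, hemisphere δ s ≤ U s) {h : Circle} {t : Fin 3 × ℤˣ → CP1 → Circle}
    (ht : ∀ v : Fin 3 × ℤˣ, v.1 ≠ 2 → ∀ x ∈ octahedralCover.U v ⊓ band δ,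
      𝒢.Parallel (O false) (O true) (t v) x)
    (htt : ∀ v w : Fin 3 × ℤˣ, v.1 ≠ 2 → w.1 ≠ 2 → ∀ x ∈ octahedralCover.U v,
      x ∈ octahedralCover.U w → x ∈ band δ → t v x = transition h v w * t w x) :
    𝒢.IsGiraudClass (octahedralCocycle h).cohomologyClass := by
  have hle : ∀ a, (hemisphereCover δ hδ).U a ≤ U a.1.2 := fun a => inf_le_right.trans (hU _)
  -- Passing to the frames of the restricted objects conjugates the values by `k`, which cancels in
  -- the cocycle identity (`conj_aux`).
  let k : (hemisphereCover δ hδ).ι → CP1 → Circle := fun a => 𝒢.resValue (hle a) (O a.1.2)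
  have hex : ∀ a b, ∃ σ : 𝒢.res (V := (hemisphereCover δ hδ).U a ⊓ (hemisphereCover δ hδ).U b)
      inf_le_right (𝒢.res (hle b) (O b.1.2)) ⟶ 𝒢.res inf_le_left (𝒢.res (hle a) (O a.1.2)),
      ∀ x ∈ (hemisphereCover δ hδ).U a ⊓ (hemisphereCover δ hδ).U b,
        𝒢.value σ x = (k b x)⁻¹ * hemisphereValue h t a.1 b.1 x * k a x := fun a b =>
    FlatU1Gerbe.exists_hom_of_parallel _ _ fun x hx =>
      (parallel_hemisphereValue 𝒢 O hδ hU h ht a b hx.1 hx.2).res (hle b) (hle a) hx.2 hx.1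
  choose σ hσ using hex
  refine ⟨hemisphereCover δ hδ, hemisphereCocycle h δ hδ, fun a => 𝒢.res (hle a) (O a.1.2), σ,
    cohomologyClass_hemisphereCocycle h δ hδ, fun a b c => ?_⟩
  rw [𝒢.cocycle_iff_value (fun a => 𝒢.res (hle a) (O a.1.2)) σ]
  intro x hx
  rw [hσ b c x ⟨hx.1.2, hx.2⟩, hσ a b x hx.1, hσ a c x ⟨hx.1.1, hx.2⟩]
  exact conj_aux (B := Additive Circle)
    (hemisphereValue_cocycle (fun hx v w hv hw hxv hxw => htt v w hv hw x hxv hxw hx)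
      a b c hx.1.1 hx.1.2 hx.2)

end CP1

/-! ### The holonomy around the equator -/

namespace CP1

open Classical in
/-- The vertex whose star contains the point of the equator at time `r`. -/
noncomputable def arcVertex (r : ℝ) : Fin 3 × ℤˣ :=
  -- The curve meets the vertices at times `0`, `1/4`, `1/2`, `3/4`, `1`; the changes of star are
  -- halfway between.
  if r < 1 / 8 then (0, 1) else if r < 3 / 8 then (1, 1) else if r < 5 / 8 then (0, -1)
  else if r < 7 / 8 then (1, -1) else (0, 1)

open Classical in
/-- The factor by which the section over the star of `arcVertex r` has to be multiplied so that it
continues the section over the first star along the equator. -/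
noncomputable def arcConst (h : Circle) (r : ℝ) : Circle := if r < 7 / 8 then 1 else h

theorem arcVertex_fst_ne_two (r : ℝ) : (arcVertex r).1 ≠ 2 := by
  unfold arcVertex
  split_ifs <;> simp

theorem arcVertex_ne_of_lt {r : ℝ} (h : r < 5 / 8) : arcVertex r ≠ (1, -1) := by
  unfold arcVertex
  split_ifs <;> simp

theorem arcVertex_ne_of_mem {r : ℝ} (h : 1 / 8 < r) (h' : r < 7 / 8) : arcVertex r ≠ (0, 1) := by
  unfold arcVertex
  rw [if_neg h.not_gt]
  split_ifs <;> simp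

theorem arcVertex_of_mem {r : ℝ} (h : 5 / 8 < r) (h' : r < 7 / 8) : arcVertex r = (1, -1) := by
  unfold arcVertex
  rw [if_neg (by linarith), if_neg (by linarith), if_neg (by linarith), if_pos h']

theorem arcVertex_of_le {r : ℝ} (h : 7 / 8 ≤ r) : arcVertex r = (0, 1) := by
  unfold arcVertex
  rw [if_neg (by linarith), if_neg (by linarith), if_neg (by linarith), if_neg (by linarith)]

/-- The rescaled sections continue each other. The jump of `arcConst` at `7/8` compensates for the
only non-trivial transition, from the star of `-e₁` to that of `e₀`. -/
theorem eventually_arcConst (h : Circle) (r : ℝ) :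
    ∀ᶠ r' in nhds r, arcConst h r' * transition h (arcVertex r') (arcVertex r) = arcConst h r := by
  have hone : ∀ r', r < 7 / 8 → r' < 7 / 8 →
      (arcVertex r ≠ (1, -1) ∧ arcVertex r' ≠ (1, -1) ∨
        arcVertex r ≠ (0, 1) ∧ arcVertex r' ≠ (0, 1)) →
      arcConst h r' * transition h (arcVertex r') (arcVertex r) = arcConst h r := by
    intro r' hr hr' H
    rw [arcConst, arcConst, if_pos hr, if_pos hr', one_mul, transition, if_neg (by tauto),
      if_neg (by tauto)]
  rcases lt_or_ge r (5 / 8) with h₁ | h₁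
  · filter_upwards [Iio_mem_nhds h₁] with r' h₂
    have h₂ : r' < 5 / 8 := h₂
    exact hone r' (by linarith) (by linarith) (.inl ⟨arcVertex_ne_of_lt h₁, arcVertex_ne_of_lt h₂⟩)
  rcases lt_or_ge r (7 / 8) with h₂ | h₂
  · filter_upwards [Ioo_mem_nhds (show 1 / 8 < r by linarith) h₂] with r' h₃
    exact hone r' h₂ h₃.2 (.inr ⟨arcVertex_ne_of_mem (by linarith) h₂,
      arcVertex_ne_of_mem h₃.1 h₃.2⟩)
  · filter_upwards [Ioi_mem_nhds (show 5 / 8 < r by linarith)] with r' h₃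
    rw [arcVertex_of_le h₂, arcConst, arcConst, if_neg h₂.not_gt]
    rcases lt_or_ge r' (7 / 8) with h₄ | h₄
    · rw [arcVertex_of_mem h₃ h₄, if_pos h₄, one_mul, transition, if_neg (by simp),
        if_pos ⟨rfl, rfl⟩]
    · rw [arcVertex_of_le h₄, if_neg h₄.not_gt, transition_self, mul_one]

theorem equator_mem_star (t : unitInterval) : equator t ∈ octahedralCover.U (arcVertex t) := by
  obtain ⟨r, hr0, hr1⟩ := t
  rw [mem_star, coord_equator]
  have hπ := Real.pi_pos
  have hc := Real.cos_sub_two_pi (2 * Real.pi * r)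
  have hs := Real.sin_sub_two_pi (2 * Real.pi * r)
  dsimp only
  unfold arcVertex
  split_ifs with h₁ h₂ h₃ h₄
  · have := Real.cos_pos_of_mem_Ioo (x := 2 * Real.pi * r) ⟨by nlinarith, by nlinarith⟩
    simpa using this
  · have := Real.sin_pos_of_pos_of_lt_pi (x := 2 * Real.pi * r) (by nlinarith) (by nlinarith)
    simpa using this
  · have := Real.cos_neg_of_pi_div_two_lt_of_lt (x := 2 * Real.pi * r) (by nlinarith) (by nlinarith)
    simpa using this
  · have := Real.sin_neg_of_neg_of_neg_pi_lt (x := 2 * Real.pi * r - 2 * Real.pi) (by nlinarith)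
      (by nlinarith)
    rw [hs] at this
    simpa using this
  · have := Real.cos_pos_of_mem_Ioo (x := 2 * Real.pi * r - 2 * Real.pi)
      ⟨by nlinarith, by nlinarith⟩
    rw [hc] at this
    simpa using this

theorem equator_mem_band {δ : ℝ} (hδ : 0 < δ) (t : unitInterval) : equator t ∈ band δ := by
  change |coord (equator t) 2| < δ * (|coord (equator t) 0| + |coord (equator t) 1|)
  have hsq := sum_coord_sq (equator t)
  have h2 : coord (equator t) 2 = 0 := by rw [coord_equator]; rfl
  rw [h2] at hsq ⊢
  rw [abs_zero]
  refine mul_pos hδ ?_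
  by_contra hn
  have h0 := abs_nonneg (coord (equator t) 0)
  have h1 := abs_nonneg (coord (equator t) 1)
  rw [abs_eq_zero.1 (by linarith : |coord (equator t) 0| = 0),
    abs_eq_zero.1 (by linarith : |coord (equator t) 1| = 0)] at hsq
  norm_num at hsq

theorem equator_zero_eq_one : equator 0 = equator 1 := by
  apply coord_injective
  rw [coord_equator, coord_equator]
  simp

theorem isHolonomy_equator (𝒢 : FlatU1Gerbe.{0, v, w} CP1) {Up Um : Opens CP1} (Op : 𝒢.Obj Up)
    (Om : 𝒢.Obj Um) {δ : ℝ} (hδ : 0 < δ) (hp : band δ ≤ Up) (hm : band δ ≤ Um) {h : Circle}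
    {t : Fin 3 × ℤˣ → CP1 → Circle}
    (ht : ∀ v : Fin 3 × ℤˣ, v.1 ≠ 2 → ∀ x ∈ octahedralCover.U v ⊓ band δ,
      𝒢.Parallel Om Op (t v) x)
    (htt : ∀ v w : Fin 3 × ℤˣ, v.1 ≠ 2 → w.1 ≠ 2 → ∀ x ∈ octahedralCover.U v,
      x ∈ octahedralCover.U w → x ∈ band δ → t v x = transition h v w * t w x) :
    (𝒢.quotientBundle Op Om).IsHolonomy equator h := by
  let B : ℝ → Opens CP1 := fun r => octahedralCover.U (arcVertex r) ⊓ band δ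
  have hB : ∀ r, B r ≤ Up ⊓ Um := fun r => inf_le_right.trans (le_inf hp hm)
  have hex : ∀ r, ∃ σ : 𝒢.res (hB r) (𝒢.res inf_le_right Om : 𝒢.Obj (Up ⊓ Um)) ⟶
      𝒢.res (hB r) (𝒢.res inf_le_left Op : 𝒢.Obj (Up ⊓ Um)), ∀ x ∈ B r, 𝒢.value σ x =
        (𝒢.resValue inf_le_right Om x)⁻¹ * t (arcVertex r) x * 𝒢.resValue inf_le_left Op x :=
    fun r => FlatU1Gerbe.exists_hom_of_parallel _ _ fun x hx =>
      (ht _ (arcVertex_fst_ne_two r) x hx).res inf_le_right inf_le_left (hB r hx) (hB r hx)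
  choose σ hσ using hex
  let T : ℝ → Over (Up ⊓ Um) := fun r => Over.mk (homOfLE (hB r))
  let s : ∀ r, (𝒢.quotientBundle Op Om).sections.obj (op (T r)) := fun r => σ r
  have hval : ∀ r c, ∀ x ∈ B r, FlatU1Gerbe.sectionValue (LocallyConstant.const (T r).left c • s r)
      x = (𝒢.resValue inf_le_right Om x)⁻¹ * t (arcVertex r) x * 𝒢.resValue inf_le_left Op x * c :=
    fun r c x hx => (FlatU1Gerbe.sectionValue_smul (T := T r) _ _ hx).trans
      (congrArg (· * c) (hσ r x hx))
  have hmem : ∀ τ : unitInterval, equator τ ∈ B τ := fun τ =>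
    ⟨equator_mem_star τ, equator_mem_band hδ τ⟩
  refine ⟨fun τ => T τ, fun τ => LocallyConstant.const (T τ).left (arcConst h τ) • s τ, hmem,
    fun τ => ?_, ?_⟩
  · filter_upwards [equator.continuous.continuousAt.eventually ((B τ).isOpen.mem_nhds (hmem τ)),
      continuous_subtype_val.continuousAt.eventually (eventually_arcConst h τ)] with τ' h₁ h₂
    refine FlatU1Gerbe.sameGerm_of_eventually_eq (hmem τ') h₁ ?_
    filter_upwards [(B τ).isOpen.mem_nhds h₁, (B τ').isOpen.mem_nhds (hmem τ')] with y hy hy'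
    rw [hval _ _ y hy, hval _ _ y hy', ← h₂, htt _ _ (arcVertex_fst_ne_two τ')
      (arcVertex_fst_ne_two τ) y hy'.1 hy.1 hy.2]
    simp only [mul_assoc, mul_comm, mul_left_comm]
  -- Both ends use the star of `e₀`, with factors `1` at the start and `h` at the end.
  · have h0 : arcVertex ((0 : unitInterval) : ℝ) = (0, 1) := by simp [arcVertex]
    have h1 : arcVertex ((1 : unitInterval) : ℝ) = (0, 1) := arcVertex_of_le (by norm_num)
    have hB01 : B ((0 : unitInterval) : ℝ) = B ((1 : unitInterval) : ℝ) := by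
      simp only [B, h0, h1]
    have hmem0 : equator 1 ∈ B ((0 : unitInterval) : ℝ) := hB01 ▸ hmem 1
    refine FlatU1Gerbe.sameGerm_of_eventually_eq (hmem 1) hmem0 ?_
    filter_upwards [(B ((0 : unitInterval) : ℝ)).isOpen.mem_nhds hmem0] with y hy
    have e := FlatU1Gerbe.sectionValue_smul (T := T ((0 : unitInterval) : ℝ))
      (LocallyConstant.const (T ((0 : unitInterval) : ℝ)).left h)
      (LocallyConstant.const (T ((0 : unitInterval) : ℝ)).left
        (arcConst h ((0 : unitInterval) : ℝ)) •
        s ((0 : unitInterval) : ℝ)) hy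
    refine (hval _ _ y (hB01 ▸ hy)).trans (Eq.trans ?_ e.symm)
    rw [hval _ _ y hy, h0, h1, arcConst, arcConst, if_neg (by norm_num), if_pos (by norm_num),
      mul_one]
    rfl

end CP1

theorem proposition5p1 (𝒢 : FlatU1Gerbe.{0, v, w} CP1) (Uplus Uminus : Opens CP1)
    (hplus : CP1.north ⊆ Uplus) (hminus : CP1.south ⊆ Uminus)
    (Oplus : 𝒢.Obj Uplus) (Ominus : 𝒢.Obj Uminus) :
    ∃ c : CechH2 CP1 Circle, (∀ c', 𝒢.IsGiraudClass c' ↔ c' = c) ∧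
      ∃ a : Circle, (∀ a', CP1.IsValueOnFundamentalCycle c a' ↔ a' = a) ∧
        ∀ h, (𝒢.quotientBundle Oplus Ominus).IsHolonomy CP1.equator h ↔ h = a := by
  obtain ⟨δ, hδ, hU⟩ := CP1.exists_band_le hplus hminus
  let U : Bool → Opens CP1 := fun s => cond s Uplus Uminus
  let O : ∀ s, 𝒢.Obj (U s) := fun s => match s with
    | true => Oplus
    | false => Ominus
  have hle : ∀ s, CP1.hemisphere δ s ≤ U s := by
    intro s x hx
    cases s
    · change -(δ * (|CP1.coord x 0| + |CP1.coord x 1|)) < ((-1 : ℤ) : ℝ) * CP1.coord x 2 at hx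
      rw [Int.cast_neg, Int.cast_one, neg_one_mul] at hx
      exact (hU x).2 (neg_lt_neg_iff.1 hx)
    · change -(δ * (|CP1.coord x 0| + |CP1.coord x 1|)) < ((1 : ℤ) : ℝ) * CP1.coord x 2 at hx
      rw [Int.cast_one, one_mul] at hx
      exact (hU x).1 hx
  have hp : CP1.band δ ≤ Uplus := (CP1.band_le_hemisphere δ true).trans (hle true)
  have hm : CP1.band δ ≤ Uminus := (CP1.band_le_hemisphere δ false).trans (hle false)
  -- This one `h` serves as cocycle parameter, value and holonomy; the uniqueness statements then
  -- give the three equivalences.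
  obtain ⟨h, t, ht, htt⟩ := CP1.exists_band_sections 𝒢 Oplus Ominus hδ hp hm
  have hG := CP1.isGiraudClass_octahedralCocycle 𝒢 O hδ hle ht htt
  have hV := CP1.isValueOnFundamentalCycle_octahedralCocycle h
  have hH := CP1.isHolonomy_equator 𝒢 Oplus Ominus hδ hp hm ht htt
  refine ⟨_, fun c' => ⟨fun hc' => hc'.unique _ hG, fun e => e ▸ hG⟩, h,
    fun a' => ⟨fun ha' => ha'.unique hV, fun e => e ▸ hV⟩,
    fun h' => ⟨fun H => FlatU1Gerbe.holonomy_unique CP1.equator_zero_eq_one H hH, fun e => e ▸ hH⟩⟩
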